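/- **Setting.** Let $s\in\mathbb N$, $[s]=\{1,\dots,s\}$, and let $\varphi:\mathbb R\to(0,\infty)$ be a differentiable probability density with distribution function $\Phi(x)=\int_{-\infty}^x\varphi(t)\,dt$ and inverse $\Phi^{-1}:(0,1)\to\mathbb R$; write $\varphi(\boldsymbol x)=\prod_{j=1}^s\varphi(x_j)$ and apply $\Phi^{-1}$ coordinate-wise. Let $\psi,\omega:\mathbb R\to(0,\infty)$ be measurable and let $\gamma_{\mathfrak u}>0$ for $\mathfrak u\subseteq[s]$. **Walsh functions.** For $k=\sum_i\kappa_i2^i\in\mathbb N_0$ and $x=\sum_{i\ge1}\xi_i2^{-i}\in[0,1)$ (binary digits, infinitely many $\xi_i\ne1$) let $\mathrm{wal}_k(x)=(-1)^{\kappa_0\xi_1+\kappa_1\xi_2+\cdots}$. For $k=2^{a_1}+2^{a_2}$ with $a_1>a_2\ge0$ and $0\le r<2^{a_2}$ let $w_{k,r}(x)=2^{a_2/2}\,\boldsymbol 1_{[r2^{-a_2},(r+1)2^{-a_2})}(x)\,\mathrm{wal}_k(x)$, and $$W_{k,r}(x)=\int_{-\infty}^x w_{k,r}(\Phi(y))\varphi(y)\,dy,\qquad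 \widetilde W_{k,r}(x)=\int_{-\infty}^x W_{k,r}(y)\varphi(y)\,dy .$$ **Assumption A** (with constants $C>0$, $\beta\in(0,1]$). For all such $k,r$, $$\sup_{x\in\mathbb R}\frac{|\widetilde W_{k,r}(x)|}{\varphi(x)\psi(x)}\le C\,\frac{2^{a_2/2}}{2^{a_1+\beta a_2}},\qquad \sup_{x\in\mathbb R}\frac{|\widetilde W_{k,r}(x)\varphi'(x)|}{\varphi^2(x)\omega(x)}\le C\,\frac{2^{a_2/2}}{2^{a_1+\beta a_2}} .$$ **Function space.** For $\emptyset\ne\mathfrak u\subseteq[s]$ and $\mathfrak v\subseteq\mathfrak u$ put $$\|F\|_{\mathfrak u,\mathfrak v}=\sum_{\mathfrak w\subseteq\mathfrak v}\int_{\mathbb R^{|\mathfrak u|}}\left|\int_{\mathbb R^{s-|\mathfrak u|}}\frac{\partial^{|\mathfrak u|+|\mathfrak w|}F}{\partial\boldsymbol x_{\mathfrak w}\partial\boldsymbol x_{\mathfrak u}}(\boldsymbol x)\prod_{j\notin\mathfrak u}\varphi(x_j)\,d\boldsymbol x_{[s]\setminus\mathfrak u}\right|\prod_{j\in\mathfrak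 w}\psi(x_j)\prod_{j\in\mathfrak v\setminus\mathfrak w}\omega(x_j)\,d\boldsymbol x_{\mathfrak u}$$ and $\|F\|_{\gamma,\varphi,\psi,\omega}=\max_{\emptyset\ne\mathfrak u\subseteq[s],\,\mathfrak v\subseteq\mathfrak u}\gamma_{\mathfrak u}^{-1}\|F\|_{\mathfrak u,\mathfrak v}$. Let $\mathcal F$ be the set of continuous $F:\mathbb R^s\to\mathbb R$ in $L_2(\mathbb R^s,\varphi)$ whose mixed partial derivatives of order at most two in each variable exist everywhere and do not depend on the order of differentiation, whose inner integrals above converge absolutely for almost every $\boldsymbol x_{\mathfrak u}$ (for all $\mathfrak w\subseteq\mathfrak u$), and with $\|F\|_{\gamma,\varphi,\psi,\omega}<\infty$. **Error and bound.** For points $\mathcal P=\{\boldsymbol x_0,\dots,\boldsymbol x_{2^m-1}\}$ in $(0,1)^s$ ($m\in\mathbb N_0$, repetitions allowed) put $$\mathrm{err}(F;\varphi;\mathcal P)=\int_{\mathbb R^s}F(\boldsymbol x)\varphi(\boldsymbol x)\,d\boldsymbol x-\frac1{2^m}\sum_{n=0}^{2^m-1}F(\Phi^{-1}(\boldsymbol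 x_n)).$$ Let $\mu_\beta(0)=0$, $\mu_\beta(2^{a_1})=a_1$, and $\mu_\beta(2^{a_1}+2^{a_2}+\ell)=a_1+\beta a_2$ for $a_1>a_2\ge0$, $0\le\ell<2^{a_2}$. With $C_1=\max(C,\tfrac12)$ let $$\mathcal E_{\gamma,\beta}(\mathcal P)=\sum_{\emptyset\ne\mathfrak u\subseteq[s]}\gamma_{\mathfrak u}(2C_1)^{|\mathfrak u|}\sum_{\boldsymbol k\in\mathbb N^{\mathfrak u}}2^{-\sum_{j\in\mathfrak u}\mu_\beta(k_j)}\left|\frac1{2^m}\sum_{n=0}^{2^m-1}\prod_{j\in\mathfrak u}\mathrm{wal}_{k_j}(x_{n,j})\right| .$$ **Proposition.** If Assumption A holds with constants $C,\beta$, then $\mathcal E_{\gamma,\beta}(\mathcal P)<\infty$ and, for every $F\in\mathcal F$, $$|\mathrm{err}(F;\varphi;\mathcal P)|\le\|F\|_{\gamma,\varphi,\psi,\omega}\;\mathcal E_{\gamma,\beta}(\mathcal P).$$ In particular, the worst-case error satisfies $$\sup_{F\in\mathcal F,\ \|F\|_{\gamma,\varphi,\psi,\omega}\le1}|\mathrm{err}(F;\varphi;\mathcal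 P)|\le\mathcal E_{\gamma,\beta}(\mathcal P).$$ -/

import Mathlib

open MeasureTheory
open scoped ENNReal

noncomputable section

namespace LocWalsh

/-- The cumulative distribution function `Φ(x) = ∫_{-∞}^x φ(t) dt` of a density `φ`. -/
def cdf (φ : ℝ → ℝ) (x : ℝ) : ℝ := ∫ t in Set.Iic x, φ t

/-- The inverse `Φ⁻¹` of the cumulative distribution function; for a positive density, `Φ` is a
bijection from `ℝ` onto `(0,1)`, and only values at points of `(0,1)` are ever used. -/
def invCdf (φ : ℝ → ℝ) : ℝ → ℝ := Function.invFun (cdf φ)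

/-! ### Walsh functions and order 2 localized Walsh functions -/

/-- The digit `ξ_i` in the dyadic expansion `x = ξ_1 / 2 + ξ_2 / 4 + ⋯` of `x ∈ [0,1)`
(the expansion in which infinitely many digits differ from `1`). -/
def dyadicDigit (i : ℕ) (x : ℝ) : ℕ := ⌊(2 : ℝ) ^ i * x⌋₊ % 2

/-- The Walsh function `wal_k(x) = (-1)^(κ_0 ξ_1 + κ_1 ξ_2 + ⋯)`, where `κ_i` are the binary digits
of `k`. -/
def wal (k : ℕ) (x : ℝ) : ℝ :=
  (-1) ^ (∑ i ∈ Finset.range k.size, (k.testBit i).toNat * dyadicDigit (i + 1) x)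

/-- The order 2 localized Walsh function `w_{k,m,2}` for `k = 2^a₁ + 2^a₂`, `a₁ > a₂`, and
`0 ≤ m < 2^a₂`. -/
def locWal (a₁ a₂ m : ℕ) (x : ℝ) : ℝ :=
  (2 : ℝ) ^ ((a₂ : ℝ) / 2) *
    Set.indicator (Set.Ico ((m : ℝ) / 2 ^ a₂) (((m : ℝ) + 1) / 2 ^ a₂))
      (wal (2 ^ a₁ + 2 ^ a₂)) x

/-- The cumulated function `W^{(φ)}_{k,m,2}(x) = ∫_{-∞}^x w_{k,m,2}(Φ(y)) φ(y) dy`. -/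
def cumWal (φ : ℝ → ℝ) (a₁ a₂ m : ℕ) (x : ℝ) : ℝ :=
  ∫ y in Set.Iic x, locWal a₁ a₂ m (cdf φ y) * φ y

/-- The twice cumulated function `∫_{-∞}^x W^{(φ)}_{k,m,2}(y) φ(y) dy`. -/
def cumCumWal (φ : ℝ → ℝ) (a₁ a₂ m : ℕ) (x : ℝ) : ℝ :=
  ∫ y in Set.Iic x, cumWal φ a₁ a₂ m y * φ y

/-- The condition on the density `φ` and the weight functions `ψ, ω`, with constant `C > 0` and
parameter `β ∈ (0,1]`. -/
structure AssumptionA (φ ψ ω : ℝ → ℝ) (C β : ℝ) : Prop where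
  C_pos : 0 < C
  β_pos : 0 < β
  β_le_one : β ≤ 1
  bound_psi : ∀ a₁ a₂ m : ℕ, a₂ < a₁ → m < 2 ^ a₂ → ∀ x : ℝ,
    |cumCumWal φ a₁ a₂ m x| / (φ x * ψ x) ≤
      C * ((2 : ℝ) ^ ((a₂ : ℝ) / 2) / (2 : ℝ) ^ ((a₁ : ℝ) + β * (a₂ : ℝ)))
  bound_omega : ∀ a₁ a₂ m : ℕ, a₂ < a₁ → m < 2 ^ a₂ → ∀ x : ℝ,
    |cumCumWal φ a₁ a₂ m x * deriv φ x| / (φ x ^ 2 * ω x) ≤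
      C * ((2 : ℝ) ^ ((a₂ : ℝ) / 2) / (2 : ℝ) ^ ((a₁ : ℝ) + β * (a₂ : ℝ)))

/-! ### The weighted function space -/

/-- The partial derivative of `F` in the `j`-th coordinate. -/
def partialD {s : ℕ} (j : Fin s) (F : (Fin s → ℝ) → ℝ) (x : Fin s → ℝ) : ℝ :=
  deriv (fun t => F (Function.update x j t)) (x j)

/-- The mixed partial derivative `∂^α F`, of order `α j` in the `j`-th coordinate. -/
def mixedD {s : ℕ} (α : Fin s → ℕ) (F : (Fin s → ℝ) → ℝ) : (Fin s → ℝ) → ℝ :=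
  (List.finRange s).foldr (fun j G => (partialD j)^[α j] G) F

/-- All mixed partial derivatives of `F` of order at most two in each coordinate exist at every
point, and they do not depend on the order of differentiation. -/
def HasMixedPartials {s : ℕ} (F : (Fin s → ℝ) → ℝ) : Prop :=
  ∀ α : Fin s → ℕ, (∀ i, α i ≤ 2) → ∀ j : Fin s, α j < 2 → ∀ x : Fin s → ℝ,
    HasDerivAt (fun t => mixedD α F (Function.update x j t))
      (mixedD (Function.update α j (α j + 1)) F x) (x j)

/-- The multi-index of `∂^(|u|+|w|) / (∂x_w ∂x_u)`. -/
def multiIndex {s : ℕ} (u w : Finset (Fin s)) (j : Fin s) : ℕ :=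
  (if j ∈ u then 1 else 0) + (if j ∈ w then 1 else 0)

/-- The point of `ℝ^s` with coordinates `y` in `u` and `z` outside `u`. -/
def glue {s : ℕ} (u : Finset (Fin s)) (y : {j // j ∈ u} → ℝ) (z : {j // j ∉ u} → ℝ) :
    Fin s → ℝ :=
  fun j => if h : j ∈ u then y ⟨j, h⟩ else z ⟨j, h⟩

/-- The integrand in `x_{[s] ∖ u}`, for given `x_u = y`, of the inner integral of the norm. -/
def innerFun {s : ℕ} (φ : ℝ → ℝ) (F : (Fin s → ℝ) → ℝ) (u w : Finset (Fin s))
    (y : {j // j ∈ u} → ℝ) (z : {j // j ∉ u} → ℝ) : ℝ :=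
  mixedD (multiIndex u w) F (glue u y z) * ∏ j, φ (z j)

/-- The weight `∏_{j ∈ w} ψ(x_j) ∏_{j ∈ v ∖ w} ω(x_j)`, for `w ⊆ v ⊆ u`. -/
def normWeight {s : ℕ} (ψ ω : ℝ → ℝ) (u v w : Finset (Fin s)) (y : {j // j ∈ u} → ℝ) : ℝ :=
  ∏ j : {j // j ∈ u}, if j.1 ∈ w then ψ (y j) else if j.1 ∈ v then ω (y j) else 1

/-- The quantity `‖F‖_{u,v}`, with values in `[0,∞]`. -/
def normUV {s : ℕ} (φ ψ ω : ℝ → ℝ) (F : (Fin s → ℝ) → ℝ) (u v : Finset (Fin s)) : ℝ≥0∞ :=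
  ∑ w ∈ v.powerset, ∫⁻ y : {j // j ∈ u} → ℝ,
    ENNReal.ofReal (|∫ z : {j // j ∉ u} → ℝ, innerFun φ F u w y z| * normWeight ψ ω u v w y)

/-- The norm `‖F‖_{γ,φ,ψ,ω}`, the maximum of `‖F‖_{u,v} / γ_u` over `∅ ≠ u ⊆ [s]` and `v ⊆ u`,
with values in `[0,∞]`. -/
def wNorm {s : ℕ} (γ : Finset (Fin s) → ℝ) (φ ψ ω : ℝ → ℝ) (F : (Fin s → ℝ) → ℝ) : ℝ≥0∞ :=
  ⨆ (u : Finset (Fin s)) (_ : u.Nonempty) (v : Finset (Fin s)) (_ : v ⊆ u),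
    normUV φ ψ ω F u v / ENNReal.ofReal (γ u)

/-- The product density on `ℝ^s`. -/
def prodDensity {s : ℕ} (φ : ℝ → ℝ) (x : Fin s → ℝ) : ℝ := ∏ j, φ (x j)

/-- The space of all `F ∈ L₂(ℝ^s, φ)` with finite norm. The smoothness and `integrable_inner` say
that the derivatives and inner integrals in the norm, and the point values of `F`, are meaningful. -/
structure MemSpace {s : ℕ} (γ : Finset (Fin s) → ℝ) (φ ψ ω : ℝ → ℝ) (F : (Fin s → ℝ) → ℝ) :
    Prop where
  continuous : Continuous F
  hasMixedPartials : HasMixedPartials F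
  memLp : MemLp F 2 (volume.withDensity fun x => ENNReal.ofReal (prodDensity φ x))
  integrable_inner : ∀ u w : Finset (Fin s), u.Nonempty → w ⊆ u →
    ∀ᵐ y : {j // j ∈ u} → ℝ, Integrable (innerFun φ F u w y)
  norm_lt_top : wNorm γ φ ψ ω F < ∞

/-! ### Integration error -/

/-- The integration error of the quasi-Monte Carlo rule based on the points `P 0, …, P (N - 1)`. -/
def err {s N : ℕ} (φ : ℝ → ℝ) (P : Fin N → Fin s → ℝ) (F : (Fin s → ℝ) → ℝ) : ℝ :=
  (∫ x : Fin s → ℝ, F x * prodDensity φ x) -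
    (1 / (N : ℝ)) * ∑ n, F (fun j => invCdf φ (P n j))

/-- The worst-case error: the supremum of `|err|` over the unit ball of the space. -/
def wce {s N : ℕ} (γ : Finset (Fin s) → ℝ) (φ ψ ω : ℝ → ℝ) (P : Fin N → Fin s → ℝ) : ℝ≥0∞ :=
  ⨆ (F : (Fin s → ℝ) → ℝ) (_ : MemSpace γ φ ψ ω F) (_ : wNorm γ φ ψ ω F ≤ 1),
    ENNReal.ofReal |err φ P F|

/-- The weight `μ_β(k)`: `0` for `k = 0`, `a₁` for `k = 2^a₁`, and `a₁ + β a₂` for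
`k = 2^a₁ + 2^a₂ + ℓ` with `a₁ > a₂` and `0 ≤ ℓ < 2^a₂`. -/
def mu (β : ℝ) (k : ℕ) : ℝ :=
  if k = 0 then 0
  else if k = 2 ^ Nat.log 2 k then (Nat.log 2 k : ℝ)
  else (Nat.log 2 k : ℝ) + β * (Nat.log 2 (k - 2 ^ Nat.log 2 k) : ℝ)

/-- The bound `E_{γ,β}(P)`; the constant `C` enters through `C₁ = max(C, 1/2)`. It is a sum of
nonnegative terms, formed in `[0,∞]`. -/
def errBound {s N : ℕ} (γ : Finset (Fin s) → ℝ) (C β : ℝ) (P : Fin N → Fin s → ℝ) : ℝ≥0∞ :=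
  ∑ u : Finset (Fin s) with u.Nonempty,
    ENNReal.ofReal (γ u * (2 * max C (1 / 2)) ^ u.card) *
      ∑' k : {j // j ∈ u} → ℕ+,
        ENNReal.ofReal (1 / (2 : ℝ) ^ (∑ j, mu β (k j)) *
          |1 / (N : ℝ) * ∑ n, ∏ j, wal (k j) (P n j)|)

end LocWalsh

end

noncomputable section

namespace LocWalsh

open Set Filter Topology

/-! ### Binary digits and Walsh functions -/

/-! Expand `F ∘ Φ⁻¹` in the Walsh system. The coefficient at `k = 0` is the integral of `F`, so the
error is minus the sum over `k ≠ 0` of the Walsh coefficient times the mean of `wal_k` over the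
points. The bound follows once the coefficient is at most `‖F‖ γ_u (2C₁)^|u| 2^(-Σ μ_β(k_j))`, where
`u` is the support of `k` (`enorm_walCoeff_le`).

This decay comes from integration by parts in every variable of `u`. If `k_j = 2^a`, one step is
made, and the primitive of the Walsh function is at most `2^(-a)`. If `k_j` has at least two digits
`1`, a second step is made; with `V` the second primitive, it leaves `V(Φ)/φ` against the second
derivative and `-V(Φ)φ'/φ²` against the first. On a dyadic interval of length `2^(-a₂)` the digits
below `a₂` contribute a constant sign, and both primitives vanish at its left end, so `|V|` is there
a multiple of the localized second primitive (`abs_locWalInt₂_eq`) and Assumption A applies. With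
`v` the set of variables treated twice, the terms of the expansion, indexed by `w ⊆ v`, are those of
`‖F‖_{u,v}`.

Two analytic points remain. The norm controls only means over the variables outside `u`, whereas
Fubini needs joint integrability; an `L₁` Poincaré inequality bounds the deviation from the mean by
derivatives in one more variable, and induction concludes (`lintegral_mixedD_lt_top`). The boundary
terms of the second step vanish because a nonzero limit would bound an integrable function below by
a multiple of the derivative of `log Φ` or `log (1 - Φ)` (`eq_zero_of_tendsto_mul`).

Partial Walsh sums over the cubes `[0, 2^n)^s` are averages of `F` over shrinking boxes, hence
converge at the quadrature points (`tendsto_sum_walCoeff`). The bound is uniform in `n` and passes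
to the limit. -/

lemma dyadicDigit_lt_two (i : ℕ) (x : ℝ) : dyadicDigit i x < 2 := Nat.mod_lt _ two_pos

lemma measurable_wal (k : ℕ) : Measurable (wal k) := by
  unfold wal dyadicDigit
  refine (measurable_from_top (f := fun n : ℕ => (-1 : ℝ) ^ n)).comp ?_
  refine Finset.measurable_sum _ fun i _ => Measurable.const_mul ?_ _
  exact (measurable_from_top (f := fun n : ℕ => n % 2)).comp
    (Nat.measurable_floor.comp (measurable_const_mul _))

lemma abs_wal (k : ℕ) (x : ℝ) : |wal k x| = 1 := by
  rw [wal, abs_pow, abs_neg, abs_one, one_pow]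

@[simp] lemma wal_zero (x : ℝ) : wal 0 x = 1 := by simp [wal]

/-- The exponent of the Walsh function may be summed over any range containing all digits. -/
lemma wal_eq_of_lt {k n : ℕ} (h : k < 2 ^ n) (x : ℝ) :
    wal k x = (-1) ^ (∑ i ∈ Finset.range n, (k.testBit i).toNat * dyadicDigit (i + 1) x) := by
  rw [wal]
  congr 1
  refine Finset.sum_subset (Finset.range_mono (Nat.size_le.2 h)) fun i _ hi => ?_
  rw [Finset.mem_range, not_lt] at hi
  rw [Nat.testBit_eq_false_of_lt (Nat.size_le.1 hi)]
  simp

lemma wal_two_pow_add {k n : ℕ} (h : k < 2 ^ n) (x : ℝ) :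
    wal (2 ^ n + k) x = (-1) ^ dyadicDigit (n + 1) x * wal k x := by
  have h2 : 2 ^ n + k < 2 ^ (n + 1) := by rw [pow_succ]; omega
  rw [wal_eq_of_lt h2, wal_eq_of_lt h, Finset.sum_range_succ, Nat.testBit_two_pow_add_eq,
    Nat.testBit_eq_false_of_lt h, pow_add, mul_comm]
  congr 2
  · simp
  · refine Finset.sum_congr rfl fun i hi => ?_
    rw [Nat.testBit_two_pow_add_gt (Finset.mem_range.1 hi)]

lemma floor_two_pow_succ (n : ℕ) (x : ℝ) :
    ⌊(2 : ℝ) ^ (n + 1) * x⌋₊ = 2 * ⌊(2 : ℝ) ^ n * x⌋₊ + dyadicDigit (n + 1) x := by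
  have h : ⌊(2 : ℝ) ^ n * x⌋₊ = ⌊(2 : ℝ) ^ (n + 1) * x⌋₊ / 2 := by
    rw [← Nat.floor_div_ofNat]
    congr 1
    rw [pow_succ]; ring
  rw [h, dyadicDigit, Nat.div_add_mod]

/-- The Dirichlet kernel of the Walsh system. -/
lemma sum_wal_mul_wal (n : ℕ) {x y : ℝ} (hx : x ∈ Ico (0 : ℝ) 1) (hy : y ∈ Ico (0 : ℝ) 1) :
    ∑ k ∈ Finset.range (2 ^ n), wal k x * wal k y =
      if ⌊(2 : ℝ) ^ n * x⌋₊ = ⌊(2 : ℝ) ^ n * y⌋₊ then 2 ^ n else 0 := by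
  induction n with
  | zero =>
    simp [Nat.floor_eq_zero.2 hx.2, Nat.floor_eq_zero.2 hy.2]
  | succ n ih =>
    have h : ∑ k ∈ Finset.range (2 ^ (n + 1)), wal k x * wal k y =
        (1 + (-1) ^ dyadicDigit (n + 1) x * (-1) ^ dyadicDigit (n + 1) y) *
          ∑ k ∈ Finset.range (2 ^ n), wal k x * wal k y := by
      -- The indices `k` and `2^n + k` differ in the top digit only, so the upper half of the sum is
      -- the lower half times a sign.
      rw [pow_succ, mul_two, Finset.sum_range_add, add_mul, one_mul, Finset.mul_sum]
      congr 1
      refine Finset.sum_congr rfl fun k hk => ?_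
      rw [wal_two_pow_add (Finset.mem_range.1 hk), wal_two_pow_add (Finset.mem_range.1 hk)]
      ring
    rw [h, ih, floor_two_pow_succ n x, floor_two_pow_succ n y]
    have hdx := dyadicDigit_lt_two (n + 1) x
    have hdy := dyadicDigit_lt_two (n + 1) y
    generalize dyadicDigit (n + 1) x = d at *
    generalize dyadicDigit (n + 1) y = e at *
    -- The sign factor is `2` or `0` according as the new digits agree or not, and the floors at
    -- level `n + 1` agree exactly when those at level `n` and the new digits do.
    by_cases hf : ⌊(2 : ℝ) ^ n * x⌋₊ = ⌊(2 : ℝ) ^ n * y⌋₊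
    · rw [hf, if_pos rfl]
      interval_cases d <;> interval_cases e <;> simp <;> ring
    · rw [if_neg hf, if_neg (by omega), mul_zero]

lemma floor_two_pow_mul_of_mem {n c : ℕ} {t : ℝ} (h1 : (c : ℝ) / 2 ^ n ≤ t)
    (h2 : t < ((c : ℝ) + 1) / 2 ^ n) : ⌊(2 : ℝ) ^ n * t⌋₊ = c := by
  have h := Nat.floor_eq_on_Ico c (2 ^ n * t)
  refine h ⟨?_, ?_⟩
  · rwa [div_le_iff₀' (by positivity)] at h1
  · rwa [lt_div_iff₀' (by positivity)] at h2

lemma floor_div_two_pow (n d : ℕ) (t : ℝ) :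
    ⌊(2 : ℝ) ^ n * t⌋₊ = ⌊(2 : ℝ) ^ (n + d) * t⌋₊ / 2 ^ d := by
  have := Nat.floor_div_natCast ((2 : ℝ) ^ (n + d) * t) (2 ^ d)
  rw [← this]
  congr 1
  rw [pow_add]; push_cast; field_simp

/-- Walsh functions change sign between the halves of a dyadic interval that are told apart by a
digit on which they depend. -/
lemma wal_add_half {k i c : ℕ} (hk : k.testBit i = true) {t : ℝ} (h1 : (c : ℝ) / 2 ^ i ≤ t)
    (h2 : t < ((c : ℝ) + 1 / 2) / 2 ^ i) : wal k (t + 1 / 2 ^ (i + 1)) = -wal k t := by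
  have ht0 : 0 ≤ t := le_trans (by positivity) h1
  have e0 : ⌊(2 : ℝ) ^ (i + 1) * t⌋₊ = 2 * c := by
    apply floor_two_pow_mul_of_mem
    · rw [pow_succ]; push_cast; convert h1 using 1; field_simp
    · rw [pow_succ]; push_cast; convert h2 using 1; field_simp
  -- At resolution `i + 1 + d` the shift by `2^(-(i+1))` is the integer `2^d`.
  have hge : ∀ d, ⌊(2 : ℝ) ^ (i + 1 + d) * (t + 1 / 2 ^ (i + 1))⌋₊ =
      ⌊(2 : ℝ) ^ (i + 1 + d) * t⌋₊ + 2 ^ d := by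
    intro d
    rw [← Nat.floor_add_natCast (by positivity)]
    congr 1
    rw [pow_add]; push_cast; field_simp
  have e1 : ⌊(2 : ℝ) ^ (i + 1) * (t + 1 / 2 ^ (i + 1))⌋₊ = 2 * c + 1 := by
    have := hge 0
    simpa [e0] using this
  obtain ⟨n, hn⟩ : ∃ n, k.size ≤ n ∧ i < n := ⟨max k.size (i + 1), by simp⟩
  rw [wal_eq_of_lt (Nat.size_le.1 hn.1), wal_eq_of_lt (Nat.size_le.1 hn.1),
    ← Finset.add_sum_erase _ _ (Finset.mem_range.2 hn.2),
    ← Finset.add_sum_erase _ _ (Finset.mem_range.2 hn.2), pow_add (-1 : ℝ), pow_add (-1 : ℝ)]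
  have d0 : dyadicDigit (i + 1) t = 0 := by rw [dyadicDigit, e0]; omega
  have d1 : dyadicDigit (i + 1) (t + 1 / 2 ^ (i + 1)) = 1 := by rw [dyadicDigit, e1]; omega
  rw [d0, d1, hk]
  simp only [Bool.toNat_true, mul_one, pow_one, mul_zero, pow_zero, neg_mul, one_mul, neg_inj]
  congr 1
  refine Finset.sum_congr rfl fun j hj => ?_
  congr 1
  have hne : j ≠ i := Finset.ne_of_mem_erase hj
  -- Earlier digits see only the quotient of `2c` or `2c + 1` by a positive power of two; later
  -- digits see a shift by an even integer.
  rcases lt_or_gt_of_ne hne with hji | hji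
  · obtain ⟨d, rfl⟩ := Nat.exists_eq_add_of_lt hji
    rw [dyadicDigit, dyadicDigit, floor_div_two_pow (j + 1) (d + 1) t,
      floor_div_two_pow (j + 1) (d + 1)]
    have : j + 1 + (d + 1) = j + d + 1 + 1 := by ring
    rw [this, e0, e1]
    congr 1
    rw [pow_succ, mul_comm (2 ^ d), ← Nat.div_div_eq_div_mul, ← Nat.div_div_eq_div_mul]
    congr 1
    omega
  · obtain ⟨d, rfl⟩ := Nat.exists_eq_add_of_lt hji
    have : i + d + 1 + 1 = i + 1 + (d + 1) := by ring
    rw [dyadicDigit, dyadicDigit, this, hge, pow_succ]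
    omega

/-- On a dyadic interval of length `2^(-n)`, the lower digits of `k` contribute a constant sign. -/
lemma wal_eq_of_floor_eq {l n : ℕ} (hl : l < 2 ^ n) {t q : ℝ}
    (h : ⌊(2 : ℝ) ^ n * t⌋₊ = ⌊(2 : ℝ) ^ n * q⌋₊) : wal l t = wal l q := by
  rw [wal_eq_of_lt hl, wal_eq_of_lt hl]
  congr 1
  refine Finset.sum_congr rfl fun j hj => ?_
  rw [Finset.mem_range] at hj
  obtain ⟨d, rfl⟩ := Nat.exists_eq_add_of_lt hj
  congr 1
  rw [dyadicDigit, dyadicDigit, floor_div_two_pow (j + 1) d, floor_div_two_pow (j + 1) d q]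
  have : j + 1 + d = j + d + 1 := by ring
  rw [this, h]

/-- Right-continuity is what gives `walInt` a right derivative at every point, jumps included. -/
lemma wal_right_const (k : ℕ) {p : ℝ} (hp : 0 ≤ p) : ∀ᶠ x in 𝓝[≥] p, wal k x = wal k p := by
  have h1 : p < ((⌊(2 : ℝ) ^ k.size * p⌋₊ : ℝ) + 1) / 2 ^ k.size := by
    rw [lt_div_iff₀' (by positivity)]
    exact Nat.lt_floor_add_one _
  filter_upwards [Ico_mem_nhdsGE h1] with x hx
  refine wal_eq_of_floor_eq (Nat.size_le.1 le_rfl) (floor_two_pow_mul_of_mem (le_trans ?_ hx.1) hx.2)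
  rw [div_le_iff₀' (by positivity)]
  exact Nat.floor_le (by positivity)

/-! ### Integrals of Walsh functions -/

/-- The primitive of the `k`-th Walsh function. -/
def walInt (k : ℕ) (p : ℝ) : ℝ := ∫ t in (0 : ℝ)..p, wal k t

/-- The second primitive of the `k`-th Walsh function. -/
def walInt₂ (k : ℕ) (p : ℝ) : ℝ := ∫ t in (0 : ℝ)..p, walInt k t

lemma intervalIntegrable_wal (k : ℕ) (a b : ℝ) : IntervalIntegrable (wal k) volume a b := by
  refine (intervalIntegrable_const (c := (1 : ℝ))).mono_fun
    (measurable_wal k).aestronglyMeasurable (Eventually.of_forall fun x => ?_)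
  simp [abs_wal]

lemma continuous_walInt (k : ℕ) : Continuous (walInt k) :=
  intervalIntegral.continuous_primitive (intervalIntegrable_wal k) 0

lemma walInt_sub (k : ℕ) (p q : ℝ) : walInt k p - walInt k q = ∫ t in q..p, wal k t :=
  intervalIntegral.integral_interval_sub_left (intervalIntegrable_wal k _ _)
    (intervalIntegrable_wal k _ _)

lemma walInt₂_sub (k : ℕ) (p q : ℝ) : walInt₂ k p - walInt₂ k q = ∫ t in q..p, walInt k t :=
  intervalIntegral.integral_interval_sub_left ((continuous_walInt k).intervalIntegrable _ _)
    ((continuous_walInt k).intervalIntegrable _ _)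

@[simp] lemma walInt_at_zero (k : ℕ) : walInt k 0 = 0 := intervalIntegral.integral_same

@[simp] lemma walInt₂_at_zero (k : ℕ) : walInt₂ k 0 = 0 := intervalIntegral.integral_same

lemma abs_walInt_sub_le (k : ℕ) (p q : ℝ) : |walInt k p - walInt k q| ≤ |p - q| := by
  rw [walInt_sub]
  simpa using intervalIntegral.norm_integral_le_of_norm_le_const (a := q) (b := p) (C := 1)
    (f := wal k) fun x _ => by simp [abs_wal]

/-- The integral of a function over an interval vanishes if it changes sign between the halves. -/
lemma integral_eq_zero_of_add_half {g : ℝ → ℝ} (hg : ∀ a b, IntervalIntegrable g volume a b)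
    {q h : ℝ} (hh : 0 ≤ h) (H : ∀ t ∈ Ioo q (q + h), g (t + h) = -g t) :
    ∫ t in q..(q + h + h), g t = 0 := by
  rw [← intervalIntegral.integral_add_adjacent_intervals (hg q (q + h)) (hg (q + h) (q + h + h)),
    ← intervalIntegral.integral_comp_add_right,
    intervalIntegral.integral_congr_Ioo_of_le (by linarith) H, intervalIntegral.integral_neg,
    add_neg_cancel]

lemma succ_div_two_pow (c i : ℕ) :
    ((c + 1 : ℕ) : ℝ) / 2 ^ i = (c : ℝ) / 2 ^ i + 1 / 2 ^ (i + 1) + 1 / 2 ^ (i + 1) := by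
  rw [pow_succ]; push_cast; field_simp; ring

/-- The sign change between halves makes the integral over each interval of length `2^(-i)` vanish.
-/
lemma walInt_dyadic {k i : ℕ} (hk : k.testBit i = true) (c : ℕ) :
    walInt k ((c : ℝ) / 2 ^ i) = 0 := by
  induction c with
  | zero => simp
  | succ c ih =>
    have e := walInt_sub k (((c + 1 : ℕ) : ℝ) / 2 ^ i) ((c : ℝ) / 2 ^ i)
    rw [ih, sub_zero] at e
    rw [e, succ_div_two_pow]
    refine integral_eq_zero_of_add_half (h := 1 / 2 ^ (i + 1)) (intervalIntegrable_wal k)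
      (by positivity) fun t ht => ?_
    refine wal_add_half hk ht.1.le (ht.2.trans_eq ?_)
    rw [pow_succ]; field_simp

/-- The first primitive also changes sign between the halves of such an interval: it vanishes at the
left end thanks to the digit `a₂` and at the midpoint thanks to the digit `a₁`, and its derivative
changes sign. This is where two digits are needed. -/
lemma walInt₂_dyadic {k a₁ a₂ : ℕ} (h : a₂ < a₁) (h1 : k.testBit a₁ = true)
    (h2 : k.testBit a₂ = true) (c : ℕ) : walInt₂ k ((c : ℝ) / 2 ^ a₂) = 0 := by
  obtain ⟨d, rfl⟩ := Nat.exists_eq_add_of_lt h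
  induction c with
  | zero => simp
  | succ c ih =>
    have e := walInt₂_sub k (((c + 1 : ℕ) : ℝ) / 2 ^ a₂) ((c : ℝ) / 2 ^ a₂)
    rw [ih, sub_zero] at e
    rw [e, succ_div_two_pow]
    refine integral_eq_zero_of_add_half (h := 1 / 2 ^ (a₂ + 1))
      (fun a b => (continuous_walInt k).intervalIntegrable a b) (by positivity) fun t ht => ?_
    have e1 : walInt k ((c : ℝ) / 2 ^ a₂) = 0 := walInt_dyadic h2 c
    -- As `a₁ = a₂ + d + 1`, the midpoint is a multiple of `2^(-a₁)`.
    have e2 : walInt k ((c : ℝ) / 2 ^ a₂ + 1 / 2 ^ (a₂ + 1)) = 0 := by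
      convert walInt_dyadic h1 ((2 * c + 1) * 2 ^ d) using 2
      rw [pow_succ, add_right_comm, pow_add, pow_succ]; push_cast; field_simp
    rw [← sub_zero (walInt k t), ← e1, ← sub_zero (walInt k (t + _)), ← e2, walInt_sub, walInt_sub,
      ← intervalIntegral.integral_comp_add_right, ← intervalIntegral.integral_neg]
    refine intervalIntegral.integral_congr_Ioo_of_le ht.1.le fun x hx => ?_
    refine wal_add_half h2 hx.1.le ((hx.2.trans ht.2).trans_eq ?_)
    rw [pow_succ]; field_simp

lemma walInt_one {k i : ℕ} (hk : k.testBit i = true) : walInt k 1 = 0 := by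
  simpa using walInt_dyadic hk (2 ^ i)

lemma walInt₂_one {k a₁ a₂ : ℕ} (h : a₂ < a₁) (h1 : k.testBit a₁ = true)
    (h2 : k.testBit a₂ = true) : walInt₂ k 1 = 0 := by
  simpa using walInt₂_dyadic h h1 h2 (2 ^ a₂)

lemma floor_div_le {n : ℕ} {p : ℝ} (hp : 0 ≤ p) : (⌊(2 : ℝ) ^ n * p⌋₊ : ℝ) / 2 ^ n ≤ p := by
  rw [div_le_iff₀' (by positivity)]
  exact Nat.floor_le (by positivity)

lemma lt_floor_add_one_div (n : ℕ) (p : ℝ) : p < ((⌊(2 : ℝ) ^ n * p⌋₊ : ℝ) + 1) / 2 ^ n := by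
  rw [lt_div_iff₀' (by positivity)]
  exact Nat.lt_floor_add_one _

lemma abs_walInt_le {k i : ℕ} (hk : k.testBit i = true) {p : ℝ} (hp : 0 ≤ p) :
    |walInt k p| ≤ 1 / 2 ^ i := by
  have h := abs_walInt_sub_le k p ((⌊(2 : ℝ) ^ i * p⌋₊ : ℝ) / 2 ^ i)
  rw [walInt_dyadic hk, sub_zero] at h
  refine h.trans ?_
  rw [abs_of_nonneg (sub_nonneg.2 (floor_div_le hp))]
  have := lt_floor_add_one_div i p
  rw [add_div] at this
  linarith

/-- Since `|walInt k| ≤ 1` on `[0, ∞)`. Compared with the zeros at `0` and `1`, this yields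
`|walInt₂ k p| ≤ min p (1 - p)` on `[0, 1]`, the decay used for the boundary terms. -/
lemma abs_walInt₂_sub_le {k i : ℕ} (hk : k.testBit i = true) {p q : ℝ} (hp : 0 ≤ p) (hq : 0 ≤ q) :
    |walInt₂ k p - walInt₂ k q| ≤ |p - q| := by
  rw [walInt₂_sub]
  have := intervalIntegral.norm_integral_le_of_norm_le_const (a := q) (b := p) (C := 1)
    (f := walInt k) fun x hx => ?_
  · simpa using this
  · refine (abs_walInt_le hk ((le_min hq hp).trans ?_)).trans ?_
    · exact (uIoc_subset_uIcc hx).1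
    · rw [div_le_one (by positivity)]
      exact one_le_pow₀ one_le_two

lemma hasDerivAt_walInt₂ (k : ℕ) (p : ℝ) : HasDerivAt (walInt₂ k) (walInt k p) p :=
  intervalIntegral.integral_hasDerivAt_right ((continuous_walInt k).intervalIntegrable _ _)
    ((continuous_walInt k).stronglyMeasurableAtFilter _ _) (continuous_walInt k).continuousAt

lemma hasDerivWithinAt_walInt (k : ℕ) {p : ℝ} (hp : 0 ≤ p) :
    HasDerivWithinAt (walInt k) (wal k p) (Ici p) p :=
  intervalIntegral.integral_hasDerivWithinAt_right (t := Ioi p) (intervalIntegrable_wal k _ _)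
    ((measurable_wal k).stronglyMeasurable.stronglyMeasurableAtFilter)
    (tendsto_const_nhds.congr' (by
      filter_upwards [nhdsWithin_mono p Ioi_subset_Ici_self (wal_right_const k hp)] with x hx
      exact hx.symm))

/-! ### Localization -/

/-- The primitive of the localized Walsh function. -/
def locWalInt (a₁ a₂ r : ℕ) (p : ℝ) : ℝ := ∫ t in (0 : ℝ)..p, locWal a₁ a₂ r t

/-- The second primitive of the localized Walsh function. -/
def locWalInt₂ (a₁ a₂ r : ℕ) (p : ℝ) : ℝ := ∫ t in (0 : ℝ)..p, locWalInt a₁ a₂ r t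

lemma measurable_locWal (a₁ a₂ r : ℕ) : Measurable (locWal a₁ a₂ r) :=
  ((measurable_wal _).indicator measurableSet_Ico).const_mul _

lemma intervalIntegrable_locWal (a₁ a₂ r : ℕ) (a b : ℝ) :
    IntervalIntegrable (locWal a₁ a₂ r) volume a b := by
  refine (intervalIntegrable_const (c := (2 : ℝ) ^ ((a₂ : ℝ) / 2))).mono_fun
    (measurable_locWal a₁ a₂ r).aestronglyMeasurable (Eventually.of_forall fun x => ?_)
  simp only [locWal, norm_mul]
  refine mul_le_of_le_one_right (norm_nonneg _) ((norm_indicator_le_norm_self _ _).trans ?_)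
  simp [abs_wal]

lemma continuous_locWalInt (a₁ a₂ r : ℕ) : Continuous (locWalInt a₁ a₂ r) :=
  intervalIntegral.continuous_primitive (intervalIntegrable_locWal a₁ a₂ r) 0

lemma two_add_lt {a₁ a₂ l : ℕ} (h : a₂ < a₁) (hl : l < 2 ^ a₂) : 2 ^ a₂ + l < 2 ^ a₁ :=
  calc 2 ^ a₂ + l < 2 ^ (a₂ + 1) := by rw [pow_succ]; omega
      _ ≤ 2 ^ a₁ := Nat.pow_le_pow_right two_pos h

/-- The factor `wal l` is constant on dyadic intervals of length `2^(-a₂)`; this reduces all `k`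
with leading digits `a₁, a₂` to the one in Assumption A. -/
lemma wal_eq_mul {a₁ a₂ l : ℕ} (h : a₂ < a₁) (hl : l < 2 ^ a₂) (x : ℝ) :
    wal (2 ^ a₁ + (2 ^ a₂ + l)) x = wal l x * wal (2 ^ a₁ + 2 ^ a₂) x := by
  rw [wal_two_pow_add (two_add_lt h hl), wal_two_pow_add hl,
    wal_two_pow_add (Nat.pow_lt_pow_right one_lt_two h),
    show 2 ^ a₂ = 2 ^ a₂ + 0 from rfl, wal_two_pow_add (by positivity), wal_zero]
  ring

lemma testBit_fst {a₁ a₂ l : ℕ} (h : a₂ < a₁) (hl : l < 2 ^ a₂) :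
    (2 ^ a₁ + (2 ^ a₂ + l)).testBit a₁ = true := by
  rw [Nat.testBit_two_pow_add_eq, Nat.testBit_eq_false_of_lt (two_add_lt h hl)]; rfl

lemma testBit_snd {a₁ a₂ l : ℕ} (h : a₂ < a₁) (hl : l < 2 ^ a₂) :
    (2 ^ a₁ + (2 ^ a₂ + l)).testBit a₂ = true := by
  rw [Nat.testBit_two_pow_add_gt h, Nat.testBit_two_pow_add_eq, Nat.testBit_eq_false_of_lt hl]; rfl

/-- On each dyadic interval of length `2^(-a₂)`, the second primitive of a Walsh function agrees up
to a factor with that of a localized Walsh function. -/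
lemma abs_locWalInt₂_eq {a₁ a₂ l : ℕ} (h : a₂ < a₁) (hl : l < 2 ^ a₂) {p : ℝ} (hp : 0 ≤ p) :
    |locWalInt₂ a₁ a₂ ⌊(2 : ℝ) ^ a₂ * p⌋₊ p| =
      (2 : ℝ) ^ ((a₂ : ℝ) / 2) * |walInt₂ (2 ^ a₁ + (2 ^ a₂ + l)) p| := by
  set r := ⌊(2 : ℝ) ^ a₂ * p⌋₊ with hr
  set k := 2 ^ a₁ + (2 ^ a₂ + l) with hk
  set q : ℝ := (r : ℝ) / 2 ^ a₂ with hq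
  set K : ℝ := (2 : ℝ) ^ ((a₂ : ℝ) / 2) with hK
  have hq0 : 0 ≤ q := by positivity
  have hqp : q ≤ p := floor_div_le hp
  have hp1 : p < ((r : ℝ) + 1) / 2 ^ a₂ := lt_floor_add_one_div a₂ p
  have hfl : ∀ t ∈ Icc q p, ⌊(2 : ℝ) ^ a₂ * t⌋₊ = r := fun t ht =>
    floor_two_pow_mul_of_mem ht.1 (ht.2.trans_lt hp1)
  have hsq : wal l q * wal l q = 1 := by
    rw [← abs_mul_abs_self, abs_wal, one_mul]
  -- The sign `wal l` is frozen at its value at the left end `q`; being `±1`, it can be moved to the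
  -- other side.
  have hloc : ∀ t ∈ Icc q p, locWal a₁ a₂ r t = K * wal l q * wal k t := by
    intro t ht
    rw [locWal, indicator_of_mem (show t ∈ Ico _ _ from ⟨ht.1, ht.2.trans_lt hp1⟩), hk,
      wal_eq_mul h hl, wal_eq_of_floor_eq hl ((hfl t ht).trans (hfl q ⟨le_rfl, hqp⟩).symm),
      ← hK]
    linear_combination (-K * wal (2 ^ a₁ + 2 ^ a₂) t) * hsq
  -- The localized function vanishes left of `q`, so its primitives start from zero there.
  have hzero : ∀ t ∈ Icc 0 q, locWalInt a₁ a₂ r t = 0 := by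
    intro t ht
    rw [locWalInt, intervalIntegral.integral_congr_Ioo_of_le ht.1 (g := fun _ => 0)]
    · simp
    · intro x hx
      have : x ∉ Ico ((r : ℝ) / 2 ^ a₂) (((r : ℝ) + 1) / 2 ^ a₂) := fun hx' =>
        absurd (hx.2.trans_le ht.2) (not_lt.2 hx'.1)
      simp [locWal, indicator_of_notMem this]
  have hint : ∀ t ∈ Icc q p, locWalInt a₁ a₂ r t = K * wal l q * walInt k t := by
    intro t ht
    have e0 : walInt k q = 0 := walInt_dyadic (testBit_snd h hl) r
    rw [← sub_zero (walInt k t), ← e0, walInt_sub, ← intervalIntegral.integral_const_mul,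
      ← sub_zero (locWalInt a₁ a₂ r t), ← hzero q ⟨hq0, le_rfl⟩, locWalInt, locWalInt,
      intervalIntegral.integral_interval_sub_left (intervalIntegrable_locWal ..)
        (intervalIntegrable_locWal ..)]
    exact intervalIntegral.integral_congr_Ioo_of_le ht.1 fun x hx =>
      hloc x ⟨hx.1.le, hx.2.le.trans ht.2⟩
  have hI : ∀ a b, IntervalIntegrable (locWalInt a₁ a₂ r) volume a b := fun a b =>
    (continuous_locWalInt a₁ a₂ r).intervalIntegrable a b
  -- The global second primitive restarts from zero at `q` as well, so no additive constant
  -- separates the two.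
  have e1 : walInt₂ k q = 0 := walInt₂_dyadic h (testBit_fst h hl) (testBit_snd h hl) r
  have e2 : locWalInt₂ a₁ a₂ r p = K * wal l q * walInt₂ k p := by
    rw [← sub_zero (walInt₂ k p), ← e1, walInt₂_sub, ← intervalIntegral.integral_const_mul,
      locWalInt₂, ← intervalIntegral.integral_add_adjacent_intervals (hI 0 q) (hI q p),
      intervalIntegral.integral_congr_Ioo_of_le hq0 (g := fun _ => 0) fun x hx =>
        hzero x ⟨hx.1.le, hx.2.le⟩]
    simp only [intervalIntegral.integral_zero, zero_add]
    exact intervalIntegral.integral_congr_Ioo_of_le hqp fun x hx => hint x ⟨hx.1.le, hx.2.le⟩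
  rw [e2, abs_mul, abs_mul, abs_wal, mul_one, abs_of_pos (by positivity)]

/-! ### The distribution function -/

/-- A positive differentiable probability density. -/
structure IsDensity (φ : ℝ → ℝ) : Prop where
  pos : ∀ x, 0 < φ x
  integral_eq_one : ∫ x, φ x = 1
  differentiable : Differentiable ℝ φ

namespace IsDensity

variable {φ : ℝ → ℝ}

lemma integrable (h : IsDensity φ) : Integrable φ := by
  by_contra hn
  have := h.integral_eq_one
  rw [integral_undef hn] at this
  exact zero_ne_one this

lemma continuous (h : IsDensity φ) : Continuous φ := h.differentiable.continuous

lemma measurable (h : IsDensity φ) : Measurable φ := h.continuous.measurable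

lemma hasDerivAt_cdf (h : IsDensity φ) (x : ℝ) : HasDerivAt (cdf φ) (φ x) x := by
  have e : cdf φ = fun x => (∫ t in (0 : ℝ)..x, φ t) + cdf φ 0 := by
    funext x
    rw [← intervalIntegral.integral_Iic_sub_Iic h.integrable.integrableOn h.integrable.integrableOn]
    simp [cdf]
  rw [e]
  exact (intervalIntegral.integral_hasDerivAt_right (h.continuous.intervalIntegrable _ _)
    (h.continuous.stronglyMeasurableAtFilter _ _) h.continuous.continuousAt).add_const _

lemma continuous_cdf (h : IsDensity φ) : Continuous (cdf φ) :=
  continuous_iff_continuousAt.2 fun x => (h.hasDerivAt_cdf x).continuousAt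

lemma strictMono_cdf (h : IsDensity φ) : StrictMono (cdf φ) :=
  strictMono_of_deriv_pos fun x => by rw [(h.hasDerivAt_cdf x).deriv]; exact h.pos x

lemma tendsto_cdf_atBot (_h : IsDensity φ) : Tendsto (cdf φ) atBot (𝓝 0) :=
  tendsto_integral_Iic_zero tendsto_id

lemma tendsto_cdf_atTop (h : IsDensity φ) : Tendsto (cdf φ) atTop (𝓝 1) := by
  rw [← h.integral_eq_one]
  exact (aecover_Iic tendsto_id).integral_tendsto_of_countably_generated h.integrable

lemma cdf_pos (h : IsDensity φ) (x : ℝ) : 0 < cdf φ x :=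
  (h.strictMono_cdf.monotone.le_of_tendsto h.tendsto_cdf_atBot (x - 1)).trans_lt
    (h.strictMono_cdf (by linarith))

lemma cdf_lt_one (h : IsDensity φ) (x : ℝ) : cdf φ x < 1 :=
  (h.strictMono_cdf (by linarith)).trans_le
    (h.strictMono_cdf.monotone.ge_of_tendsto h.tendsto_cdf_atTop (x + 1))

lemma exists_cdf_eq (h : IsDensity φ) {p : ℝ} (hp : p ∈ Ioo (0 : ℝ) 1) : ∃ x, cdf φ x = p := by
  obtain ⟨a, ha⟩ := (h.tendsto_cdf_atBot.eventually_lt_const hp.1).exists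
  obtain ⟨b, hb⟩ := (h.tendsto_cdf_atTop.eventually_const_lt hp.2).exists
  exact mem_range_of_exists_le_of_exists_ge h.continuous_cdf ⟨a, ha.le⟩ ⟨b, hb.le⟩

lemma cdf_invCdf (h : IsDensity φ) {p : ℝ} (hp : p ∈ Ioo (0 : ℝ) 1) : cdf φ (invCdf φ p) = p :=
  Function.invFun_eq (h.exists_cdf_eq hp)

/-- Substitution `p = Φ(y)`. -/
lemma setIntegral_comp_cdf (h : IsDensity φ) (g : ℝ → ℝ) (x : ℝ) :
    ∫ y in Iic x, g (cdf φ y) * φ y = ∫ p in (0 : ℝ)..cdf φ x, g p := by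
  have e : cdf φ '' Iic x = Ioc 0 (cdf φ x) := by
    ext p
    constructor
    · rintro ⟨y, hy, rfl⟩
      exact ⟨h.cdf_pos y, h.strictMono_cdf.monotone hy⟩
    · rintro ⟨h0, h1⟩
      obtain ⟨y, rfl⟩ := h.exists_cdf_eq ⟨h0, h1.trans_lt (h.cdf_lt_one x)⟩
      exact ⟨y, h.strictMono_cdf.le_iff_le.1 h1, rfl⟩
  rw [intervalIntegral.integral_of_le (h.cdf_pos x).le, ← e,
    integral_image_eq_integral_abs_deriv_smul measurableSet_Iic
      (fun y _ => (h.hasDerivAt_cdf y).hasDerivWithinAt) h.strictMono_cdf.injective.injOn]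
  refine integral_congr_ae (Eventually.of_forall fun y => ?_)
  simp only [abs_of_pos (h.pos y), smul_eq_mul, mul_comm]

lemma integral_comp_cdf (h : IsDensity φ) (g : ℝ → ℝ) :
    ∫ y, g (cdf φ y) * φ y = ∫ p in (0 : ℝ)..1, g p := by
  have e : cdf φ '' univ = Ioo 0 1 := by
    ext p
    constructor
    · rintro ⟨y, hy, rfl⟩
      exact ⟨h.cdf_pos y, h.cdf_lt_one y⟩
    · intro hp
      obtain ⟨y, rfl⟩ := h.exists_cdf_eq hp
      exact ⟨y, trivial, rfl⟩
  rw [intervalIntegral.integral_of_le zero_le_one, integral_Ioc_eq_integral_Ioo, ← e,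
    integral_image_eq_integral_abs_deriv_smul MeasurableSet.univ
      (fun y _ => (h.hasDerivAt_cdf y).hasDerivWithinAt) h.strictMono_cdf.injective.injOn,
    setIntegral_univ]
  refine integral_congr_ae (Eventually.of_forall fun y => ?_)
  simp only [abs_of_pos (h.pos y), smul_eq_mul, mul_comm]

lemma cumWal_eq (h : IsDensity φ) (a₁ a₂ r : ℕ) (x : ℝ) :
    cumWal φ a₁ a₂ r x = locWalInt a₁ a₂ r (cdf φ x) := h.setIntegral_comp_cdf _ _

lemma cumCumWal_eq (h : IsDensity φ) (a₁ a₂ r : ℕ) (x : ℝ) :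
    cumCumWal φ a₁ a₂ r x = locWalInt₂ a₁ a₂ r (cdf φ x) := by
  simp only [cumCumWal, h.cumWal_eq]
  exact h.setIntegral_comp_cdf _ _

lemma integral_wal_cdf (h : IsDensity φ) {k : ℕ} (hk : k ≠ 0) :
    ∫ y, wal k (cdf φ y) * φ y = 0 := by
  obtain ⟨i, hi⟩ := Nat.exists_testBit_of_ne_zero hk
  rw [h.integral_comp_cdf]
  exact walInt_one hi

end IsDensity

/-! ### Bounds for the kernels -/

/-- The case distinction on which `mu` and the number of integrations by parts depend. -/
lemma nat_cases {k : ℕ} (hk : k ≠ 0) : (∃ a, k = 2 ^ a) ∨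
    ∃ a₁ a₂ l, a₂ < a₁ ∧ l < 2 ^ a₂ ∧ k = 2 ^ a₁ + (2 ^ a₂ + l) := by
  have h1 := Nat.pow_log_le_self 2 hk
  have h2 := Nat.lt_pow_succ_log_self one_lt_two k
  obtain ⟨d, hd⟩ := Nat.exists_eq_add_of_le h1
  rcases eq_or_ne d 0 with rfl | h0
  · exact Or.inl ⟨_, hd⟩
  · right
    have h3 := Nat.pow_log_le_self 2 h0
    have h4 := Nat.lt_pow_succ_log_self one_lt_two d
    obtain ⟨l, hl⟩ := Nat.exists_eq_add_of_le h3
    rw [pow_succ] at h2 h4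
    refine ⟨Nat.log 2 k, Nat.log 2 d, l, ?_, by omega, by omega⟩
    rw [← Nat.pow_lt_pow_iff_right one_lt_two]
    omega

lemma log_two_pow_add {a l : ℕ} (hl : l < 2 ^ a) : Nat.log 2 (2 ^ a + l) = a :=
  Nat.log_eq_of_pow_le_of_lt_pow (by omega) (by rw [pow_succ]; omega)

lemma mu_two_pow (β : ℝ) (a : ℕ) : mu β (2 ^ a) = a := by
  simp [mu, Nat.log_pow]

lemma ne_two_pow_log {a₁ a₂ l : ℕ} (h : a₂ < a₁) (hl : l < 2 ^ a₂) :
    2 ^ a₁ + (2 ^ a₂ + l) ≠ 2 ^ Nat.log 2 (2 ^ a₁ + (2 ^ a₂ + l)) := by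
  rw [log_two_pow_add (two_add_lt h hl)]
  have : 0 < 2 ^ a₂ := by positivity
  omega

lemma mu_add (β : ℝ) {a₁ a₂ l : ℕ} (h : a₂ < a₁) (hl : l < 2 ^ a₂) :
    mu β (2 ^ a₁ + (2 ^ a₂ + l)) = a₁ + β * a₂ := by
  have h0 : 2 ^ a₁ + (2 ^ a₂ + l) ≠ 0 := by positivity
  rw [mu, if_neg h0, if_neg (ne_two_pow_log h hl), log_two_pow_add (two_add_lt h hl),
    Nat.add_sub_cancel_left, log_two_pow_add hl]

/-- The factor of the first derivative when the `k`-th Walsh coefficient is integrated by parts. -/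
def ker₁ (φ : ℝ → ℝ) (k : ℕ) (x : ℝ) : ℝ :=
  if k = 2 ^ Nat.log 2 k then -walInt k (cdf φ x)
  else -(walInt₂ k (cdf φ x) * deriv φ x / φ x ^ 2)

/-- The factor of the second derivative when the `k`-th Walsh coefficient is integrated by parts. -/
def ker₂ (φ : ℝ → ℝ) (k : ℕ) (x : ℝ) : ℝ :=
  if k = 2 ^ Nat.log 2 k then 0 else walInt₂ k (cdf φ x) / φ x

variable {φ ψ ω : ℝ → ℝ} {C β : ℝ}

lemma continuous_walInt₂ (k : ℕ) : Continuous (walInt₂ k) :=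
  continuous_iff_continuousAt.2 fun p => (hasDerivAt_walInt₂ k p).continuousAt

lemma measurable_ker₁ (h : IsDensity φ) (k : ℕ) : Measurable (ker₁ φ k) := by
  unfold ker₁
  split_ifs
  · exact ((continuous_walInt k).comp h.continuous_cdf).measurable.neg
  · exact ((((continuous_walInt₂ k).comp h.continuous_cdf).measurable.mul
      (measurable_deriv φ)).div (h.measurable.pow_const 2)).neg

lemma measurable_ker₂ (h : IsDensity φ) (k : ℕ) : Measurable (ker₂ φ k) := by
  unfold ker₂
  split_ifs
  · exact measurable_const
  · exact ((continuous_walInt₂ k).comp h.continuous_cdf).measurable.div h.measurable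

/-- Needs neither Assumption A nor a weight. A single-digit index admits only one integration by
parts: its second primitive does not vanish at `1`. -/
lemma abs_ker₁_two_pow_le (h : IsDensity φ) (β : ℝ) {k : ℕ} (hk : k = 2 ^ Nat.log 2 k) (x : ℝ) :
    |ker₁ φ k x| ≤ 1 / 2 ^ mu β k := by
  rw [ker₁, if_pos hk, abs_neg]
  have hb : k.testBit (Nat.log 2 k) = true := by
    conv_lhs => rw [hk]
    rw [Nat.log_pow one_lt_two, Nat.testBit_two_pow_self]
  refine (abs_walInt_le hb (h.cdf_pos x).le).trans_eq ?_
  rw [hk, mu_two_pow, Nat.log_pow one_lt_two, Real.rpow_natCast]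

/-- The normalization `K = 2^(a₂/2)` of the localized functions cancels from Assumption A. -/
lemma bound_aux {v K b : ℝ} {w : ℝ} (hw : 0 < w) (hK : 0 < K)
    (H : K * v / w ≤ C * (K / b)) : v ≤ C * (1 / b) * w := by
  rw [div_le_iff₀ hw] at H
  have : K * v ≤ K * (C * (1 / b) * w) := H.trans_eq (by ring)
  exact le_of_mul_le_mul_left this hK

/-- For each `x`, Assumption A is applied with the index of the dyadic interval that contains
`Φ(x)`, so a different localized function may serve at each point. -/
lemma abs_ker₂_le (h : IsDensity φ) (hψ : ∀ x, 0 < ψ x) (hA : AssumptionA φ ψ ω C β) {k : ℕ}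
    (hk0 : k ≠ 0) (hk : k ≠ 2 ^ Nat.log 2 k) (x : ℝ) :
    |ker₂ φ k x| ≤ C * (1 / 2 ^ mu β k) * ψ x := by
  rw [ker₂, if_neg hk]
  rcases nat_cases hk0 with ⟨a, rfl⟩ | ⟨a₁, a₂, l, h1, h2, rfl⟩
  · simp [Nat.log_pow] at hk
  have hp := (h.cdf_pos x).le
  have hr : ⌊(2 : ℝ) ^ a₂ * cdf φ x⌋₊ < 2 ^ a₂ := by
    rw [Nat.floor_lt (by positivity)]
    push_cast
    exact mul_lt_of_lt_one_right (by positivity) (h.cdf_lt_one x)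
  have H := hA.bound_psi a₁ a₂ _ h1 hr x
  rw [h.cumCumWal_eq, abs_locWalInt₂_eq h1 h2 hp] at H
  have hφ := h.pos x
  have := bound_aux (mul_pos hφ (hψ x)) (by positivity) H
  rw [mu_add β h1 h2, abs_div, abs_of_pos hφ, div_le_iff₀ hφ]
  linarith

lemma abs_ker₁_le (h : IsDensity φ) (hω : ∀ x, 0 < ω x) (hA : AssumptionA φ ψ ω C β) {k : ℕ}
    (hk0 : k ≠ 0) (hk : k ≠ 2 ^ Nat.log 2 k) (x : ℝ) :
    |ker₁ φ k x| ≤ C * (1 / 2 ^ mu β k) * ω x := by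
  rw [ker₁, if_neg hk, abs_neg]
  rcases nat_cases hk0 with ⟨a, rfl⟩ | ⟨a₁, a₂, l, h1, h2, rfl⟩
  · simp [Nat.log_pow] at hk
  have hp := (h.cdf_pos x).le
  have hr : ⌊(2 : ℝ) ^ a₂ * cdf φ x⌋₊ < 2 ^ a₂ := by
    rw [Nat.floor_lt (by positivity)]
    push_cast
    exact mul_lt_of_lt_one_right (by positivity) (h.cdf_lt_one x)
  have H := hA.bound_omega a₁ a₂ _ h1 hr x
  rw [h.cumCumWal_eq, abs_mul, abs_locWalInt₂_eq h1 h2 hp, mul_assoc, ← abs_mul] at H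
  have hφ := pow_pos (h.pos x) 2
  have := bound_aux (mul_pos hφ (hω x)) (by positivity) H
  rw [mu_add β h1 h2, abs_div, abs_of_pos hφ, div_le_iff₀ hφ]
  linarith

/-! ### Integration by parts in one variable -/

lemma integrable_mul_of_abs_le {α : Type*} {mα : MeasurableSpace α} {μ : Measure α}
    {f K ρ : α → ℝ} {c : ℝ} (h : Integrable (fun x => f x * ρ x) μ) (hf : AEStronglyMeasurable f μ)
    (hK : AEStronglyMeasurable K μ) (hle : ∀ x, |K x| ≤ c * ρ x) :
    Integrable (fun x => f x * K x) μ := by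
  refine (h.const_mul c).mono (hf.mul hK) (Eventually.of_forall fun x => ?_)
  rw [norm_mul, mul_left_comm, norm_mul]
  exact mul_le_mul_of_nonneg_left ((hle x).trans (le_abs_self _)) (norm_nonneg _)

/-- One-sided derivatives suffice here because `walInt` has corners at the jumps of `wal`. -/
lemma integral_eq_sub_of_hasDeriv_right_of_tendsto {G G' : ℝ → ℝ} {a b : ℝ} (hc : Continuous G)
    (hG : ∀ x, HasDerivWithinAt G (G' x) (Ioi x) x) (hi : Integrable G')
    (ha : Tendsto G atBot (𝓝 a)) (hb : Tendsto G atTop (𝓝 b)) : ∫ x, G' x = b - a := by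
  refine tendsto_nhds_unique
    (intervalIntegral_tendsto_integral hi tendsto_neg_atTop_atBot tendsto_id) ?_
  refine ((hb.comp tendsto_id).sub (ha.comp tendsto_neg_atTop_atBot)).congr fun x => ?_
  exact (intervalIntegral.integral_eq_sub_of_hasDeriv_right hc.continuousOn (fun x _ => hG x)
    hi.intervalIntegrable).symm

lemma tendsto_atTop_of_integrable_deriv {f f' : ℝ → ℝ} (hf : ∀ x, HasDerivAt f (f' x) x)
    (hf' : Integrable f') : ∃ L, Tendsto f atTop (𝓝 L) :=
  ⟨_, tendsto_limUnder_of_hasDerivAt_of_integrableOn_Ioi (a := 0) (fun x _ => hf x)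
    hf'.integrableOn⟩

lemma tendsto_atBot_of_integrable_deriv {f f' : ℝ → ℝ} (hf : ∀ x, HasDerivAt f (f' x) x)
    (hf' : Integrable f') : ∃ L, Tendsto f atBot (𝓝 L) :=
  ⟨_, tendsto_limUnder_of_hasDerivAt_of_integrableOn_Iic (a := 0) (fun x _ => hf x)
    hf'.integrableOn⟩

/-- An integrable function is not bounded below by a multiple of a logarithmic derivative `g'/g`
along a filter along which `g` tends to zero. -/
lemma eq_zero_of_tendsto_mul {f v g g' : ℝ → ℝ} {L : ℝ} {l : Filter ℝ} [NeBot l]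
    [TendstoIxxClass Icc l l] (hf : Integrable f) (hg : ∀ x, HasDerivAt g (g' x) x)
    (hg0 : ∀ x, 0 < g x) (hg' : ∀ x, g' x ≠ 0) (hl : Tendsto g l (𝓝 0)) (hv : ∀ x, |v x| ≤ g x)
    (h : Tendsto (fun x => f x / |g' x| * v x) l (𝓝 L)) : L = 0 := by
  by_contra hL
  have hL' := abs_pos.2 hL
  -- `log g` is unbounded along `l`, so no integrable function dominates `g'/g`. If `L ≠ 0`, the
  -- product eventually exceeds `|L|/2`, and `|v| ≤ g` turns this into `|g'|/g ≤ (2/|L|) |f|`.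
  refine not_integrableOn_of_tendsto_norm_atTop_of_deriv_isBigO_filter (f := fun x => Real.log (g x))
    (g := f) (k := univ) l univ_mem ?_ ?_ ?_ hf.integrableOn
  · exact Eventually.of_forall fun x => ((hg x).log (hg0 x).ne').differentiableAt
  · refine tendsto_abs_atBot_atTop.comp (Real.tendsto_log_nhdsGT_zero.comp ?_)
    exact tendsto_nhdsWithin_iff.2 ⟨hl, Eventually.of_forall hg0⟩
  · refine Asymptotics.IsBigO.of_bound (2 / |L|) ?_
    filter_upwards [h.abs.eventually_const_lt (half_lt_self hL')] with x hx
    have h1 := abs_pos.2 (hg' x)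
    rw [((hg x).log (hg0 x).ne').deriv, norm_div, Real.norm_eq_abs, Real.norm_eq_abs,
      Real.norm_eq_abs, abs_of_pos (hg0 x), div_le_iff₀ (hg0 x)]
    rw [abs_mul, abs_div, abs_abs] at hx
    have h2 : |f x| / |g' x| * |v x| ≤ |f x| / |g' x| * g x :=
      mul_le_mul_of_nonneg_left (hv x) (by positivity)
    have h3 := hx.le.trans h2
    rw [div_mul_eq_mul_div, le_div_iff₀ h1] at h3
    rw [div_mul_eq_mul_div, div_mul_eq_mul_div, le_div_iff₀ hL']
    linarith

variable {φ ψ ω : ℝ → ℝ} {C β : ℝ}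

lemma hasDerivWithinAt_walInt_cdf (h : IsDensity φ) (k : ℕ) (x : ℝ) :
    HasDerivWithinAt (fun y => walInt k (cdf φ y)) (wal k (cdf φ x) * φ x) (Ioi x) x :=
  (hasDerivWithinAt_walInt k (h.cdf_pos x).le).comp x (h.hasDerivAt_cdf x).hasDerivWithinAt
    fun _ hy => h.strictMono_cdf.monotone (le_of_lt hy)

lemma hasDerivAt_walInt₂_cdf (h : IsDensity φ) (k : ℕ) (x : ℝ) :
    HasDerivAt (fun y => walInt₂ k (cdf φ y)) (walInt k (cdf φ x) * φ x) x :=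
  (hasDerivAt_walInt₂ k _).comp x (h.hasDerivAt_cdf x)

lemma abs_walInt_cdf_le (h : IsDensity φ) (k : ℕ) (x : ℝ) : |walInt k (cdf φ x)| ≤ 1 := by
  have := abs_walInt_sub_le k (cdf φ x) 0
  rw [walInt_at_zero, sub_zero, sub_zero, abs_of_pos (h.cdf_pos x)] at this
  exact this.trans (h.cdf_lt_one x).le

/-- The boundary terms vanish: `f` has finite limits since `f'` is integrable, and `walInt k` is
zero at both `0` and `1`. -/
lemma integral_mul_wal (h : IsDensity φ) {k : ℕ} (hk : k ≠ 0) {f f' : ℝ → ℝ}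
    (hf : ∀ x, HasDerivAt f (f' x) x) (hf' : Integrable f')
    (hfφ : Integrable fun x => f x * φ x) :
    ∫ x, f x * (wal k (cdf φ x) * φ x) = -∫ x, f' x * walInt k (cdf φ x) := by
  obtain ⟨i, hi⟩ := Nat.exists_testBit_of_ne_zero hk
  have hU : Continuous fun x => walInt k (cdf φ x) := (continuous_walInt k).comp h.continuous_cdf
  have hfc : Continuous f := continuous_iff_continuousAt.2 fun x => (hf x).continuousAt
  have i1 : Integrable fun x => f' x * walInt k (cdf φ x) := by
    refine hf'.mono (hf'.aestronglyMeasurable.mul hU.aestronglyMeasurable)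
      (Eventually.of_forall fun x => ?_)
    rw [norm_mul]
    exact mul_le_of_le_one_right (norm_nonneg _) (abs_walInt_cdf_le h k x)
  have i2 : Integrable fun x => f x * (wal k (cdf φ x) * φ x) := by
    refine hfφ.mono (hfc.aestronglyMeasurable.mul
      (((measurable_wal k).comp h.continuous_cdf.measurable).mul
        h.measurable).aestronglyMeasurable) (Eventually.of_forall fun x => ?_)
    simp [abs_wal]
  obtain ⟨a, ha⟩ := tendsto_atBot_of_integrable_deriv hf hf'
  obtain ⟨b, hb⟩ := tendsto_atTop_of_integrable_deriv hf hf'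
  have t0 : Tendsto (fun x => walInt k (cdf φ x)) atBot (𝓝 0) := by
    simpa [Function.comp_def] using ((continuous_walInt k).tendsto 0).comp h.tendsto_cdf_atBot
  have t1 : Tendsto (fun x => walInt k (cdf φ x)) atTop (𝓝 0) := by
    simpa [walInt_one hi, Function.comp_def] using ((continuous_walInt k).tendsto 1).comp h.tendsto_cdf_atTop
  have := integral_eq_sub_of_hasDeriv_right_of_tendsto (hfc.mul hU)
    (fun x => (hf x).hasDerivWithinAt.mul (hasDerivWithinAt_walInt_cdf h k x)) (i1.add i2)
    (ha.mul t0) (hb.mul t1)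
  rw [integral_add i1 i2] at this
  linarith

/-- Integrate by parts with `f'/φ` and the derivative of `walInt₂ k ∘ Φ`. The boundary product has
limits because its derivative is integrable; they are zero by `eq_zero_of_tendsto_mul`, with no
growth condition on `f'/φ`. -/
lemma integral_deriv_mul_walInt (h : IsDensity φ) {k i : ℕ} (hki : k.testBit i = true)
    (hk1 : walInt₂ k 1 = 0) {f' f'' : ℝ → ℝ}
    (hf'' : ∀ x, HasDerivAt f' (f'' x) x) (i1 : Integrable f')
    (i2 : Integrable fun x => f' x * (walInt₂ k (cdf φ x) * deriv φ x / φ x ^ 2))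
    (i3 : Integrable fun x => f'' x * (walInt₂ k (cdf φ x) / φ x)) :
    -∫ x, f' x * walInt k (cdf φ x) =
      (∫ x, f'' x * (walInt₂ k (cdf φ x) / φ x)) -
        ∫ x, f' x * (walInt₂ k (cdf φ x) * deriv φ x / φ x ^ 2) := by
  have hd : ∀ x, HasDerivAt (fun x => f' x / φ x * walInt₂ k (cdf φ x))
      (f'' x * (walInt₂ k (cdf φ x) / φ x) -
        f' x * (walInt₂ k (cdf φ x) * deriv φ x / φ x ^ 2) + f' x * walInt k (cdf φ x)) x := by
    intro x
    have hne := (h.pos x).ne'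
    refine (((hf'' x).div (h.differentiable x).hasDerivAt hne).mul
      (hasDerivAt_walInt₂_cdf h k x)).congr_deriv ?_
    rw [Pi.div_apply]
    field_simp
  have i0 : Integrable fun x => f' x * walInt k (cdf φ x) := by
    refine i1.mono (i1.aestronglyMeasurable.mul
      ((continuous_walInt k).comp h.continuous_cdf).aestronglyMeasurable)
      (Eventually.of_forall fun x => ?_)
    rw [norm_mul]
    exact mul_le_of_le_one_right (norm_nonneg _) (abs_walInt_cdf_le h k x)
  have hi := (i3.sub i2).add i0
  obtain ⟨a, ha⟩ := tendsto_atBot_of_integrable_deriv hd hi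
  obtain ⟨b, hb⟩ := tendsto_atTop_of_integrable_deriv hd hi
  have ha0 : a = 0 := by
    refine eq_zero_of_tendsto_mul (g := cdf φ) (g' := φ) (v := fun x => walInt₂ k (cdf φ x)) i1
      h.hasDerivAt_cdf h.cdf_pos (fun x => (h.pos x).ne') h.tendsto_cdf_atBot (fun x => ?_)
      (ha.congr fun x => ?_)
    · have := abs_walInt₂_sub_le hki (h.cdf_pos x).le le_rfl
      rwa [walInt₂_at_zero, sub_zero, sub_zero, abs_of_pos (h.cdf_pos x)] at this
    · rw [abs_of_pos (h.pos x)]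
  have hb0 : b = 0 := by
    -- At `+∞` the comparison function is the tail `1 - Φ`, and `walInt₂ k` is compared with its
    -- zero at `1`.
    refine eq_zero_of_tendsto_mul (g := fun x => 1 - cdf φ x) (g' := fun x => -φ x)
      (v := fun x => walInt₂ k (cdf φ x)) i1
      (fun x => (h.hasDerivAt_cdf x).const_sub 1) (fun x => sub_pos.2 (h.cdf_lt_one x))
      (fun x => neg_ne_zero.2 (h.pos x).ne')
      (by simpa using h.tendsto_cdf_atTop.const_sub 1) (fun x => ?_) (hb.congr fun x => ?_)
    · have := abs_walInt₂_sub_le hki (h.cdf_pos x).le zero_le_one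
      rwa [hk1, sub_zero, abs_sub_comm, abs_of_pos (sub_pos.2 (h.cdf_lt_one x))] at this
    · rw [abs_neg, abs_of_pos (h.pos x)]
  have := integral_of_hasDerivAt_of_tendsto hd hi ha hb
  have e := integral_add (i3.sub i2) i0
  simp only [Pi.sub_apply] at e
  rw [e, integral_sub i3 i2, ha0, hb0] at this
  linarith

/-- Covers both kinds of `k` at once. The weights `φ, 1, ω, ψ` in the hypotheses are those for which
the norm provides integrability. -/
lemma integral_mul_wal_eq_ker (h : IsDensity φ) (hψ : ∀ x, 0 < ψ x) (hω : ∀ x, 0 < ω x)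
    (hA : AssumptionA φ ψ ω C β) {k : ℕ} (hk : k ≠ 0) {f f' f'' : ℝ → ℝ}
    (hf' : ∀ x, HasDerivAt f (f' x) x) (hf'' : ∀ x, HasDerivAt f' (f'' x) x)
    (i0 : Integrable fun x => f x * φ x) (i1 : Integrable f')
    (i2 : Integrable fun x => f' x * ω x) (i3 : Integrable fun x => f'' x * ψ x) :
    ∫ x, f x * (wal k (cdf φ x) * φ x) =
      (∫ x, f' x * ker₁ φ k x) + ∫ x, f'' x * ker₂ φ k x := by
  rw [integral_mul_wal h hk hf' i1 i0]
  have m1 : Measurable f' := by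
    have : f' = deriv f := funext fun x => (hf' x).deriv.symm
    rw [this]; exact measurable_deriv f
  have m2 : Measurable f'' := by
    have : f'' = deriv f' := funext fun x => (hf'' x).deriv.symm
    rw [this]; exact measurable_deriv f'
  by_cases hp : k = 2 ^ Nat.log 2 k
  · simp only [ker₁, ker₂, if_pos hp, mul_neg, integral_neg, mul_zero, integral_zero, add_zero]
  · have j2 : Integrable fun x => f' x * ker₁ φ k x :=
      integrable_mul_of_abs_le i2 m1.aestronglyMeasurable (measurable_ker₁ h k).aestronglyMeasurable
        (abs_ker₁_le h hω hA hk hp)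
    have j3 : Integrable fun x => f'' x * ker₂ φ k x :=
      integrable_mul_of_abs_le i3 m2.aestronglyMeasurable (measurable_ker₂ h k).aestronglyMeasurable
        (abs_ker₂_le h hψ hA hk hp)
    simp only [ker₁, ker₂, if_neg hp, mul_neg] at j2 j3 ⊢
    obtain ⟨i, hi, hi1⟩ : ∃ i, k.testBit i = true ∧ walInt₂ k 1 = 0 := by
      rcases nat_cases hk with ⟨a, rfl⟩ | ⟨a₁, a₂, l, h1, h2, rfl⟩
      · simp [Nat.log_pow] at hp
      · exact ⟨a₁, testBit_fst h1 h2, walInt₂_one h1 (testBit_fst h1 h2) (testBit_snd h1 h2)⟩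
    rw [integral_deriv_mul_walInt h hi hi1 hf'' i1 (by simpa using j2.neg) j3, integral_neg]
    ring

/-! ### Product measures -/

lemma measurable_update_apply {ι : Type*} [DecidableEq ι] (i : ι) :
    Measurable fun p : (ι → ℝ) × ℝ => Function.update p.1 i p.2 := by
  refine measurable_pi_iff.2 fun j => ?_
  by_cases hj : j = i
  · subst hj; simpa using measurable_snd
  · simpa [Function.update_of_ne hj] using (measurable_pi_apply j).fun_comp measurable_fst

section Pi

variable {ι : Type*} [Fintype ι] [DecidableEq ι]

lemma lintegral_fintype_prod {f : ι → ℝ → ℝ≥0∞} (hf : ∀ i, Measurable (f i)) :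
    ∫⁻ x : ι → ℝ, ∏ i, f i (x i) = ∏ i, ∫⁻ t, f i t := by
  have hm : Measurable fun x : ι → ℝ => ∏ i, f i (x i) :=
    Finset.measurable_prod _ fun i _ => (hf i).comp (measurable_pi_apply i)
  have key : ∀ s : Finset ι, ∀ x,
      (∫⋯∫⁻_s, (fun x => ∏ i, f i (x i)) ∂(fun _ : ι => (volume : Measure ℝ))) x =
      (∏ i ∈ s, ∫⁻ t, f i t) * ∏ i ∈ sᶜ, f i (x i) := by
    intro s
    induction s using Finset.induction_on with
    | empty => intro x; simp
    | insert i s hi ih =>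
      intro x
      rw [lmarginal_insert _ hm hi, Finset.prod_insert hi]
      have hi' : i ∈ sᶜ := Finset.mem_compl.2 hi
      have e : ∀ t, (∏ j ∈ sᶜ, f j (Function.update x i t j)) =
          f i t * ∏ j ∈ (insert i s)ᶜ, f j (x j) := by
        intro t
        rw [← Finset.mul_prod_erase _ _ hi', Function.update_self, Finset.compl_insert]
        congr 1
        refine Finset.prod_congr rfl fun j hj => ?_
        rw [Function.update_of_ne (Finset.ne_of_mem_erase hj)]
      simp only [ih, e]
      rw [lintegral_const_mul _ ((hf i).mul_const _), lintegral_mul_const _ (hf i)]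
      ring
  rw [volume_pi, lintegral_eq_lmarginal_univ 0, key]
  simp

lemma pi_withDensity {f : ι → ℝ → ℝ≥0∞} (hf : ∀ i, Measurable (f i))
    [∀ i, SigmaFinite ((volume : Measure ℝ).withDensity (f i))] :
    Measure.pi (fun i => (volume : Measure ℝ).withDensity (f i)) =
      (volume : Measure (ι → ℝ)).withDensity fun x => ∏ i, f i (x i) := by
  refine Measure.pi_eq fun s hs => ?_
  rw [withDensity_apply _ (MeasurableSet.univ_pi hs), ← lintegral_indicator (MeasurableSet.univ_pi hs)]
  have e : (pi univ s).indicator (fun x : ι → ℝ => ∏ i, f i (x i)) =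
      fun x => ∏ i, (s i).indicator (f i) (x i) := by
    funext x
    by_cases hx : x ∈ pi univ s
    · rw [indicator_of_mem hx]
      exact Finset.prod_congr rfl fun i _ => (indicator_of_mem (hx i trivial) _).symm
    · rw [indicator_of_notMem hx]
      simp only [Set.mem_pi, mem_univ, true_implies, not_forall] at hx
      obtain ⟨i, hi⟩ := hx
      exact (Finset.prod_eq_zero (Finset.mem_univ i) (indicator_of_notMem hi _)).symm
  rw [e, lintegral_fintype_prod fun i => (hf i).indicator (hs i)]
  exact Finset.prod_congr rfl fun i _ => by
    rw [lintegral_indicator (hs i), withDensity_apply _ (hs i)]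

/-- A coordinate with a probability distribution may be replaced by an independent one. -/
lemma measurePreserving_update {μ μ' : ι → Measure ℝ} [∀ j, SigmaFinite (μ j)]
    [∀ j, SigmaFinite (μ' j)] (i : ι) [IsProbabilityMeasure (μ i)] (h : ∀ j, j ≠ i → μ' j = μ j) :
    MeasurePreserving (fun p : (ι → ℝ) × ℝ => Function.update p.1 i p.2)
      ((Measure.pi μ).prod (μ' i)) (Measure.pi μ') := by
  have hm := measurable_update_apply i
  refine ⟨hm, (Measure.pi_eq fun s hs => ?_).symm⟩
  have e : (fun p : (ι → ℝ) × ℝ => Function.update p.1 i p.2) ⁻¹' pi univ s =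
      pi univ (Function.update s i univ) ×ˢ s i := by
    ext ⟨x, t⟩
    simp only [mem_preimage, Set.mem_pi, mem_univ, true_implies, mem_prod]
    constructor
    · intro hx
      refine ⟨fun j => ?_, by simpa using hx i⟩
      by_cases hj : j = i
      · subst hj; simp
      · simpa [Function.update_of_ne hj] using hx j
    · rintro ⟨hx, ht⟩ j
      by_cases hj : j = i
      · subst hj; simpa using ht
      · simpa [Function.update_of_ne hj] using hx j
  rw [Measure.map_apply hm (MeasurableSet.univ_pi hs), e, Measure.prod_prod, Measure.pi_pi,
    ← Finset.mul_prod_erase _ _ (Finset.mem_univ i),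
    ← Finset.mul_prod_erase Finset.univ (fun j => μ' j (s j)) (Finset.mem_univ i),
    Function.update_self, measure_univ, one_mul, mul_comm]
  congr 1
  refine Finset.prod_congr rfl fun j hj => ?_
  rw [Function.update_of_ne (Finset.ne_of_mem_erase hj), h j (Finset.ne_of_mem_erase hj)]

/-- Resampling the coordinates in `S` from an independent copy does not change the law; the hybrid
points of the Poincaré inequality are of this form. -/
lemma measurePreserving_piecewise (ν : Measure ℝ) [IsProbabilityMeasure ν] (S : Finset ι) :
    MeasurePreserving (fun p : (ι → ℝ) × (ι → ℝ) => S.piecewise p.2 p.1)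
      ((Measure.pi fun _ : ι => ν).prod (Measure.pi fun _ : ι => ν)) (Measure.pi fun _ : ι => ν) := by
  have hm : Measurable fun p : (ι → ℝ) × (ι → ℝ) => S.piecewise p.2 p.1 := by
    refine measurable_pi_iff.2 fun j => ?_
    by_cases hj : j ∈ S
    · simpa [hj] using (measurable_pi_apply j).fun_comp measurable_snd
    · simpa [hj] using (measurable_pi_apply j).fun_comp measurable_fst
  refine ⟨hm, (Measure.pi_eq fun s hs => ?_).symm⟩
  have e : (fun p : (ι → ℝ) × (ι → ℝ) => S.piecewise p.2 p.1) ⁻¹' pi univ s =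
      pi univ (S.piecewise (fun _ => univ) s) ×ˢ pi univ (S.piecewise s fun _ => univ) := by
    ext ⟨x, y⟩
    simp only [mem_preimage, Set.mem_pi, mem_univ, true_implies, mem_prod, ← forall_and]
    refine forall_congr' fun j => ?_
    by_cases hj : j ∈ S <;> simp [hj]
  rw [Measure.map_apply hm (MeasurableSet.univ_pi hs), e, Measure.prod_prod, Measure.pi_pi,
    Measure.pi_pi, ← Finset.prod_mul_distrib]
  refine Finset.prod_congr rfl fun j _ => ?_
  by_cases hj : j ∈ S <;> simp [hj]

lemma enorm_sub_le_lintegral_deriv {f f' : ℝ → ℝ} (hf : ∀ x, HasDerivAt f (f' x) x) (a b : ℝ) :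
    ‖f a - f b‖ₑ ≤ ∫⁻ t, ‖f' t‖ₑ := by
  have hm : Measurable f' := by
    have : f' = deriv f := funext fun x => (hf x).deriv.symm
    rw [this]; exact measurable_deriv f
  by_cases ht : ∫⁻ t, ‖f' t‖ₑ = ∞
  · rw [ht]; exact le_top
  have hi : Integrable f' := ⟨hm.aestronglyMeasurable, lt_top_iff_ne_top.2 ht⟩
  rw [← intervalIntegral.integral_eq_sub_of_hasDerivAt (fun x _ => hf x) hi.intervalIntegrable,
    ← enorm_norm, intervalIntegral.norm_intervalIntegral_eq, enorm_norm]
  exact (enorm_integral_le_lintegral_enorm _).trans (setLIntegral_le_lintegral _ _)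

/-- A Poincaré inequality in `L₁` for product measures. -/
lemma lintegral_enorm_sub_le (ν : Measure ℝ) [IsProbabilityMeasure ν] {f : (ι → ℝ) → ℝ}
    {f' : ι → (ι → ℝ) → ℝ} (hfm : Measurable f) (hfm' : ∀ i, Measurable (f' i))
    (hf : ∀ i x, HasDerivAt (fun t => f (Function.update x i t)) (f' i x) (x i)) :
    ∫⁻ z, ∫⁻ z', ‖f z - f z'‖ₑ ∂(Measure.pi fun _ : ι => ν) ∂(Measure.pi fun _ : ι => ν) ≤
      ∑ i, ∫⁻ z, (∫⁻ t, ‖f' i (Function.update z i t)‖ₑ) ∂(Measure.pi fun _ : ι => ν) := by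
  set π := Measure.pi fun _ : ι => ν with hπ
  have hG : ∀ i, Measurable fun z => ∫⁻ t, ‖f' i (Function.update z i t)‖ₑ := fun i =>
    (((hfm' i).comp (measurable_update_apply i)).enorm).lintegral_prod_right'
  -- Pass from `z` to `z'` one coordinate at a time; each exchange costs at most the integral of the
  -- derivative along a full line.
  have key : ∀ S : Finset ι, ∫⁻ p, ‖f p.1 - f (S.piecewise p.2 p.1)‖ₑ ∂(π.prod π) ≤
      ∑ i ∈ S, ∫⁻ z, (∫⁻ t, ‖f' i (Function.update z i t)‖ₑ) ∂π := by
    intro S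
    induction S using Finset.induction_on with
    | empty => simp
    | insert i S hi ih =>
      rw [Finset.sum_insert hi, add_comm]
      have hpw := measurePreserving_piecewise ν S
      have hm : Measurable fun p : (ι → ℝ) × (ι → ℝ) => ‖f p.1 - f (S.piecewise p.2 p.1)‖ₑ :=
        ((hfm.comp measurable_fst).sub (hfm.comp hpw.measurable)).enorm
      calc ∫⁻ p, ‖f p.1 - f ((insert i S).piecewise p.2 p.1)‖ₑ ∂(π.prod π)
          ≤ ∫⁻ p, (‖f p.1 - f (S.piecewise p.2 p.1)‖ₑ +
              ∫⁻ t, ‖f' i (Function.update (S.piecewise p.2 p.1) i t)‖ₑ) ∂(π.prod π) := by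
            refine lintegral_mono fun p => ?_
            set X := S.piecewise p.2 p.1 with hX
            have e : (insert i S).piecewise p.2 p.1 = Function.update X i (p.2 i) := by
              rw [Finset.piecewise_insert]
            have h1 := enorm_sub_le_lintegral_deriv (f := fun t => f (Function.update X i t))
              (f' := fun t => f' i (Function.update X i t)) (fun t => by
                simpa using hf i (Function.update X i t)) (X i) (p.2 i)
            rw [Function.update_eq_self] at h1
            rw [e]
            calc _ = ‖(f p.1 - f X) + (f X - f (Function.update X i (p.2 i)))‖ₑ := by
                  rw [sub_add_sub_cancel]
              _ ≤ _ := (enorm_add_le _ _).trans (add_le_add_right h1 _)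
        _ = _ + ∫⁻ p, (∫⁻ t, ‖f' i (Function.update (S.piecewise p.2 p.1) i t)‖ₑ) ∂(π.prod π) :=
            lintegral_add_left hm _
        _ ≤ _ := by
            refine add_le_add ih (le_of_eq ?_)
            -- The hybrid point has the law of `z`.
            exact hpw.lintegral_comp (hG i)
  have := key Finset.univ
  have hm : Measurable fun p : (ι → ℝ) × (ι → ℝ) => ‖f p.1 - f p.2‖ₑ :=
    ((hfm.comp measurable_fst).sub (hfm.comp measurable_snd)).enorm
  simp only [Finset.piecewise_univ] at this
  rwa [lintegral_prod _ hm.aemeasurable] at this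

/-- The `L₁` norm is bounded by the mean and the `L₁` norms of the partial derivatives. -/
lemma lintegral_enorm_le_mean_add (ν : Measure ℝ) [IsProbabilityMeasure ν] {f : (ι → ℝ) → ℝ}
    {f' : ι → (ι → ℝ) → ℝ} (hfm : Measurable f) (hfm' : ∀ i, Measurable (f' i))
    (hf : ∀ i x, HasDerivAt (fun t => f (Function.update x i t)) (f' i x) (x i))
    (hi : Integrable f (Measure.pi fun _ : ι => ν)) :
    ∫⁻ z, ‖f z‖ₑ ∂(Measure.pi fun _ : ι => ν) ≤ ‖∫ z, f z ∂(Measure.pi fun _ : ι => ν)‖ₑ +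
      ∑ i, ∫⁻ z, (∫⁻ t, ‖f' i (Function.update z i t)‖ₑ) ∂(Measure.pi fun _ : ι => ν) := by
  set π := Measure.pi fun _ : ι => ν with hπ
  refine le_trans ?_ (add_le_add_right (lintegral_enorm_sub_le ν hfm hfm' hf) _)
  calc ∫⁻ z, ‖f z‖ₑ ∂π ≤ ∫⁻ z, (‖∫ z, f z ∂π‖ₑ + ∫⁻ z', ‖f z - f z'‖ₑ ∂π) ∂π := by
        refine lintegral_mono fun z => ?_
        have e : f z = (∫ z', f z' ∂π) + ∫ z', (f z - f z') ∂π := by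
          rw [integral_sub (integrable_const _) hi]
          simp
        calc ‖f z‖ₑ = ‖(∫ z', f z' ∂π) + ∫ z', (f z - f z') ∂π‖ₑ := by rw [← e]
          _ ≤ _ := (enorm_add_le _ _).trans
            (add_le_add_right (enorm_integral_le_lintegral_enorm _) _)
    _ = _ := by
        rw [lintegral_add_left measurable_const, lintegral_const, measure_univ, mul_one]

end Pi

/-! ### Mixed partial derivatives -/

section Mixed

variable {s : ℕ} {F : (Fin s → ℝ) → ℝ}

lemma multiIndex_le (u w : Finset (Fin s)) (j : Fin s) : multiIndex u w j ≤ 2 := by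
  unfold multiIndex
  split_ifs <;> omega

lemma mixedD_zero (F : (Fin s → ℝ) → ℝ) : mixedD 0 F = F := by
  simp [mixedD]

lemma mixedD_multiIndex_empty (F : (Fin s → ℝ) → ℝ) : mixedD (multiIndex ∅ ∅) F = F := by
  have : multiIndex (∅ : Finset (Fin s)) ∅ = 0 := by funext j; simp [multiIndex]
  rw [this, mixedD_zero]

/-- Partial derivatives of measurable functions are measurable. -/
lemma measurable_of_hasDerivAt_update {ι : Type*} [DecidableEq ι] {f f' : (ι → ℝ) → ℝ} {i : ι}
    (hf : Measurable f)
    (h : ∀ x, HasDerivAt (fun t => f (Function.update x i t)) (f' x) (x i)) : Measurable f' := by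
  have ht : Tendsto (fun n : ℕ => 1 / ((n : ℝ) + 1)) atTop (𝓝[≠] 0) :=
    tendsto_nhdsWithin_iff.2 ⟨tendsto_one_div_add_atTop_nhds_zero_nat,
      Eventually.of_forall fun n => by
        simp only [mem_compl_iff, mem_singleton_iff]; positivity⟩
  refine measurable_of_tendsto_metrizable (f := fun n x => (1 / ((n : ℝ) + 1))⁻¹ *
    (f (Function.update x i (x i + 1 / ((n : ℝ) + 1))) - f x)) (fun n => ?_)
    (tendsto_pi_nhds.2 fun x => ?_)
  · refine Measurable.const_mul (Measurable.sub (hf.comp ?_) hf) _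
    exact (measurable_update_apply i).comp
      (measurable_id.prodMk ((measurable_pi_apply i).add_const _))
  · have := (h x).tendsto_slope_zero.comp ht
    simpa [Function.comp_def] using this

/-- Continuity of the derivatives is not assumed. Measurability passes along difference quotients,
by induction on the total order; since the order of differentiation is immaterial, any coordinate
may be differentiated last. -/
lemma measurable_mixedD (hc : Continuous F) (hD : HasMixedPartials F) {α : Fin s → ℕ}
    (hα : ∀ i, α i ≤ 2) : Measurable (mixedD α F) := by
  induction hn : ∑ i, α i generalizing α with
  | zero =>
    have : α = 0 := by
      funext i
      exact (Finset.sum_eq_zero_iff.1 hn) i (Finset.mem_univ i)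
    rw [this, mixedD_zero]
    exact hc.measurable
  | succ n ih =>
    obtain ⟨j, hj⟩ : ∃ j, α j ≠ 0 := by
      by_contra! h
      simp [h] at hn
    set α' := Function.update α j (α j - 1) with hα'
    have e : Function.update α' j (α' j + 1) = α := by
      rw [hα', Function.update_self, Function.update_idem, Nat.sub_add_cancel (by omega),
        Function.update_eq_self]
    have hα2 : ∀ i, α' i ≤ 2 := by
      intro i
      by_cases hi : i = j
      · subst hi; have := hα i; simp [hα']; omega
      · simp [hα', Function.update_of_ne hi, hα i]
    have hs : ∑ i, α' i = n := by
      have h1 := Finset.add_sum_erase Finset.univ α (Finset.mem_univ j)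
      have h2 := Finset.add_sum_erase Finset.univ α' (Finset.mem_univ j)
      have h3 : ∑ i ∈ Finset.univ.erase j, α' i = ∑ i ∈ Finset.univ.erase j, α i :=
        Finset.sum_congr rfl fun i hi => Function.update_of_ne (Finset.ne_of_mem_erase hi) _ _
      have h4 : α' j = α j - 1 := Function.update_self ..
      omega
    have := hD α' hα2 j (by have := hα j; simp [hα']; omega)
    rw [e] at this
    exact measurable_of_hasDerivAt_update (ih hα2 hs) this

/-- In an integration by parts step, the first derivative in `x_j` puts `j` into `u`, and the second
puts it into `w`. -/
lemma hasDerivAt_mixedD_insert_left (hD : HasMixedPartials F) {u w : Finset (Fin s)} {j : Fin s}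
    (hu : j ∉ u) (x : Fin s → ℝ) (t : ℝ) :
    HasDerivAt (fun t => mixedD (multiIndex u w) F (Function.update x j t))
      (mixedD (multiIndex (insert j u) w) F (Function.update x j t)) t := by
  have e : Function.update (multiIndex u w) j (multiIndex u w j + 1) =
      multiIndex (insert j u) w := by
    funext i
    by_cases hi : i = j
    · subst hi; simp [multiIndex, hu, add_comm]
    · simp [multiIndex, hi]
  have := hD (multiIndex u w) (multiIndex_le u w) j
    (by simp only [multiIndex, hu, if_false]; split_ifs <;> omega) (Function.update x j t)
  rw [e] at this
  simpa using this

lemma hasDerivAt_mixedD_insert_right (hD : HasMixedPartials F) {u w : Finset (Fin s)} {j : Fin s}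
    (hw : j ∉ w) (x : Fin s → ℝ) (t : ℝ) :
    HasDerivAt (fun t => mixedD (multiIndex u w) F (Function.update x j t))
      (mixedD (multiIndex u (insert j w)) F (Function.update x j t)) t := by
  have e : Function.update (multiIndex u w) j (multiIndex u w j + 1) =
      multiIndex u (insert j w) := by
    funext i
    by_cases hi : i = j
    · subst hi; simp [multiIndex, hw]
    · simp [multiIndex, hi]
  have := hD (multiIndex u w) (multiIndex_le u w) j
    (by simp only [multiIndex, hw, if_false]; split_ifs <;> omega) (Function.update x j t)
  rw [e] at this
  simpa using this

end Mixed

/-! ### Integrability of the mixed partial derivatives -/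

/-- The measure on `ℝ` with Lebesgue density `d`. -/
def densMeasure (d : ℝ → ℝ) : Measure ℝ := volume.withDensity fun t => ENNReal.ofReal (d t)

instance (d : ℝ → ℝ) : SigmaFinite (densMeasure d) := SigmaFinite.withDensity_ofReal _

lemma densMeasure_one : densMeasure (fun _ => 1) = volume := by
  simp [densMeasure, ← Pi.one_def]

lemma IsDensity.isProbabilityMeasure {φ : ℝ → ℝ} (h : IsDensity φ) :
    IsProbabilityMeasure (densMeasure φ) := by
  refine ⟨?_⟩
  rw [densMeasure, withDensity_apply _ MeasurableSet.univ, setLIntegral_univ,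
    ← ofReal_integral_eq_lintegral_ofReal h.integrable
      (Eventually.of_forall fun x => (h.pos x).le), h.integral_eq_one, ENNReal.ofReal_one]

lemma pi_densMeasure {ι : Type*} [Fintype ι] [DecidableEq ι] {d : ι → ℝ → ℝ}
    (hm : ∀ i, Measurable (d i)) (hd : ∀ i t, 0 ≤ d i t) :
    Measure.pi (fun i => densMeasure (d i)) =
      volume.withDensity fun x => ENNReal.ofReal (∏ i, d i (x i)) := by
  have : ∀ i, SigmaFinite ((volume : Measure ℝ).withDensity fun t => ENNReal.ofReal (d i t)) :=
    fun i => SigmaFinite.withDensity_ofReal _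
  simp only [densMeasure]
  rw [pi_withDensity (f := fun i t => ENNReal.ofReal (d i t)) fun i => (hm i).ennreal_ofReal]
  congr 1
  funext x
  rw [ENNReal.ofReal_prod_of_nonneg fun i _ => hd i _]

lemma measurable_prod_apply {ι : Type*} [Fintype ι] {d : ι → ℝ → ℝ}
    (hm : ∀ i, Measurable (d i)) : Measurable fun x : ι → ℝ => ∏ i, d i (x i) :=
  Finset.measurable_prod _ fun i _ => (hm i).comp (measurable_pi_apply i)

lemma integrable_pi_densMeasure_iff {ι : Type*} [Fintype ι] [DecidableEq ι] {d : ι → ℝ → ℝ}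
    (hm : ∀ i, Measurable (d i)) (hd : ∀ i t, 0 ≤ d i t) {f : (ι → ℝ) → ℝ} :
    Integrable f (Measure.pi fun i => densMeasure (d i)) ↔
      Integrable fun x => f x * ∏ i, d i (x i) := by
  rw [pi_densMeasure hm hd, integrable_withDensity_iff (measurable_prod_apply hm).ennreal_ofReal
    (Eventually.of_forall fun x => ENNReal.ofReal_lt_top)]
  simp only [ENNReal.toReal_ofReal (Finset.prod_nonneg fun i _ => hd i _)]

lemma integral_pi_densMeasure {ι : Type*} [Fintype ι] [DecidableEq ι] {d : ι → ℝ → ℝ}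
    (hm : ∀ i, Measurable (d i)) (hd : ∀ i t, 0 ≤ d i t) (f : (ι → ℝ) → ℝ) :
    ∫ x, f x ∂(Measure.pi fun i => densMeasure (d i)) = ∫ x, f x * ∏ i, d i (x i) := by
  rw [pi_densMeasure hm hd, integral_withDensity_eq_integral_toReal_smul
    (measurable_prod_apply hm).ennreal_ofReal
    (Eventually.of_forall fun x => ENNReal.ofReal_lt_top)]
  simp only [ENNReal.toReal_ofReal (Finset.prod_nonneg fun i _ => hd i _), smul_eq_mul, mul_comm]

/-- The weight of the `j`-th coordinate in the `w`-th term of `‖F‖_{u,v}`. -/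
def dens {s : ℕ} (φ ψ ω : ℝ → ℝ) (u v w : Finset (Fin s)) (j : Fin s) : ℝ → ℝ :=
  if j ∈ w then ψ else if j ∈ v then ω else if j ∈ u then fun _ => 1 else φ

section

variable {s : ℕ} {φ ψ ω : ℝ → ℝ} {F : (Fin s → ℝ) → ℝ} {γ : Finset (Fin s) → ℝ}
  {u v w : Finset (Fin s)}

lemma dens_pos (h : IsDensity φ) (hψ : ∀ x, 0 < ψ x) (hω : ∀ x, 0 < ω x) (j : Fin s) (t : ℝ) :
    0 < dens φ ψ ω u v w j t := by
  unfold dens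
  split_ifs
  exacts [hψ t, hω t, one_pos, h.pos t]

lemma measurable_dens (h : IsDensity φ) (hψ : Measurable ψ) (hω : Measurable ω) (j : Fin s) :
    Measurable (dens φ ψ ω u v w j) := by
  unfold dens
  split_ifs
  exacts [hψ, hω, measurable_const, h.measurable]

lemma dens_of_notMem (hwv : w ⊆ v) (hvu : v ⊆ u) {j : Fin s} (hj : j ∉ u) :
    dens φ ψ ω u v w j = φ := by
  rw [dens, if_neg fun h => hj (hvu (hwv h)), if_neg fun h => hj (hvu h), if_neg hj]

lemma normWeight_eq (y : {j // j ∈ u} → ℝ) :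
    normWeight ψ ω u v w y = ∏ j, dens φ ψ ω u v w j.1 (y j) := by
  unfold normWeight dens
  refine Finset.prod_congr rfl fun j _ => ?_
  have := j.2
  split_ifs <;> rfl

lemma measurePreserving_glue (u : Finset (Fin s)) (μ : Fin s → Measure ℝ) [∀ j, SigmaFinite (μ j)] :
    MeasurePreserving (fun p : ({j // j ∈ u} → ℝ) × ({j // j ∉ u} → ℝ) => glue u p.1 p.2)
      ((Measure.pi fun j : {j // j ∈ u} => μ j).prod (Measure.pi fun j : {j // j ∉ u} => μ j))
      (Measure.pi μ) := by
  convert (measurePreserving_piEquivPiSubtypeProd μ (· ∈ u)).symm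
  rfl

lemma glue_update (u : Finset (Fin s)) (y : {j // j ∈ u} → ℝ) (z : {j // j ∉ u} → ℝ)
    (i : {j // j ∉ u}) (t : ℝ) :
    glue u y (Function.update z i t) = Function.update (glue u y z) i t := by
  funext j
  by_cases hj : j ∈ u
  · have : j ≠ i := fun h => i.2 (h ▸ hj)
    simp [glue, hj, Function.update_of_ne this]
  · by_cases hji : j = i
    · subst hji; simp [glue, hj]
    · have : (⟨j, hj⟩ : {j // j ∉ u}) ≠ i := fun h => hji (congrArg Subtype.val h)
      simp [glue, hj, Function.update_of_ne hji, Function.update_of_ne this]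

lemma normUV_le (hγ : ∀ u, 0 < γ u) (hu : u.Nonempty) (hvu : v ⊆ u) :
    normUV φ ψ ω F u v ≤ wNorm γ φ ψ ω F * ENNReal.ofReal (γ u) := by
  rw [← ENNReal.div_le_iff (ENNReal.ofReal_pos.2 (hγ u)).ne' ENNReal.ofReal_ne_top]
  exact le_iSup₂_of_le u hu (le_iSup₂_of_le v hvu le_rfl)

end

section

variable {s : ℕ} {φ ψ ω : ℝ → ℝ} {F : (Fin s → ℝ) → ℝ} {γ : Finset (Fin s) → ℝ}

lemma integrable_of_memSpace (h : IsDensity φ) (hF : MemSpace γ φ ψ ω F) :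
    Integrable F (Measure.pi fun _ => densMeasure φ) := by
  have := h.isProbabilityMeasure
  have e := pi_densMeasure (ι := Fin s) (d := fun _ => φ) (fun _ => h.measurable)
    fun _ t => (h.pos t).le
  have hm := hF.memLp
  unfold prodDensity at hm
  rw [← e] at hm
  exact hm.integrable one_le_two

/-- One summand of `‖F‖_{u,v}`, with the weights absorbed into the measure. -/
lemma lintegral_inner_lt_top (h : IsDensity φ) (hψm : Measurable ψ) (hψ : ∀ x, 0 < ψ x)
    (hωm : Measurable ω) (hω : ∀ x, 0 < ω x) (hγ : ∀ u, 0 < γ u) (hF : MemSpace γ φ ψ ω F)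
    {u v w : Finset (Fin s)} (hu : u.Nonempty) (hvu : v ⊆ u) (hwv : w ⊆ v) :
    ∫⁻ y, ‖∫ z, innerFun φ F u w y z‖ₑ
      ∂(Measure.pi fun j : {j // j ∈ u} => densMeasure (dens φ ψ ω u v w j)) < ∞ := by
  have hdm : ∀ j : {j // j ∈ u}, Measurable (dens φ ψ ω u v w j) := fun j =>
    measurable_dens h hψm hωm j.1
  have hd : ∀ (j : {j // j ∈ u}) t, 0 ≤ dens φ ψ ω u v w j t := fun j t =>
    (dens_pos h hψ hω j.1 t).le
  rw [pi_densMeasure hdm hd]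
  refine lt_of_le_of_lt (lintegral_withDensity_le_lintegral_mul _
    (measurable_prod_apply hdm).ennreal_ofReal _) ?_
  refine lt_of_le_of_lt ?_ (lt_of_le_of_lt (normUV_le hγ hu hvu)
    (ENNReal.mul_lt_top hF.norm_lt_top ENNReal.ofReal_lt_top))
  refine le_trans (le_of_eq ?_) (Finset.single_le_sum (f := fun w => ∫⁻ y : {j // j ∈ u} → ℝ,
    ENNReal.ofReal (|∫ z : {j // j ∉ u} → ℝ, innerFun φ F u w y z| * normWeight ψ ω u v w y))
    (fun _ _ => zero_le) (Finset.mem_powerset.2 hwv))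
  refine lintegral_congr fun y => ?_
  rw [normWeight_eq (φ := φ), Pi.mul_apply, ENNReal.ofReal_mul (abs_nonneg _),
    ← Real.enorm_eq_ofReal_abs, mul_comm]

/-- The mixed partial derivatives are absolutely integrable in all variables jointly. -/
lemma lintegral_mixedD_lt_top (h : IsDensity φ) (hψm : Measurable ψ) (hψ : ∀ x, 0 < ψ x)
    (hωm : Measurable ω) (hω : ∀ x, 0 < ω x) (hγ : ∀ u, 0 < γ u) (hF : MemSpace γ φ ψ ω F)
    {u v w : Finset (Fin s)} (hvu : v ⊆ u) (hwv : w ⊆ v) :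
    ∫⁻ x, ‖mixedD (multiIndex u w) F x‖ₑ
      ∂(Measure.pi fun j => densMeasure (dens φ ψ ω u v w j)) < ∞ := by
  -- Induction on the number of variables outside `u`: the norm controls the mean over them, and the
  -- deviation from the mean is controlled by the derivatives for `insert i u`, with `v` and `w`
  -- unchanged.
  induction hn : uᶜ.card using Nat.strong_induction_on generalizing u with
  | _ n ih =>
  rcases u.eq_empty_or_nonempty with rfl | hu
  · obtain rfl := Finset.subset_empty.1 hvu
    obtain rfl := Finset.subset_empty.1 hwv
    rw [mixedD_multiIndex_empty]
    have : ∀ j, dens φ ψ ω ∅ ∅ ∅ j = φ := fun j : Fin s => by simp [dens]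
    simp only [this]
    exact (integrable_of_memSpace h hF).hasFiniteIntegral
  have hν := h.isProbabilityMeasure
  have hDm : ∀ u, Measurable (mixedD (multiIndex u w) F) := fun u =>
    measurable_mixedD hF.continuous hF.hasMixedPartials (multiIndex_le u w)
  set μ : Fin s → Measure ℝ := fun j => densMeasure (dens φ ψ ω u v w j) with hμ
  set πu : Measure ({j // j ∈ u} → ℝ) := Measure.pi fun j => μ j with hπu
  have hμφ : (Measure.pi fun j : {j // j ∉ u} => μ j) = Measure.pi fun _ => densMeasure φ := by
    congr 1
    funext j
    simp only [hμ, dens_of_notMem hwv hvu j.2]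
  set πz : Measure ({j // j ∉ u} → ℝ) := Measure.pi fun _ => densMeasure φ with hπz
  have hglue : MeasurePreserving (fun p : ({j // j ∈ u} → ℝ) × ({j // j ∉ u} → ℝ) =>
      glue u p.1 p.2) (πu.prod πz) (Measure.pi μ) := by
    rw [← hμφ]; exact measurePreserving_glue u μ
  set D := mixedD (multiIndex u w) F with hDdef
  let D' : {j // j ∉ u} → (Fin s → ℝ) → ℝ := fun i => mixedD (multiIndex (insert i.1 u) w) F
  have hφm : ∀ _ : {j // j ∉ u}, Measurable φ := fun _ => h.measurable
  have hφp : ∀ (_ : {j // j ∉ u}) t, 0 ≤ φ t := fun _ t => (h.pos t).le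
  have hglue_m : ∀ y, Measurable (glue u y) := fun y =>
    hglue.measurable.comp (measurable_const.prodMk measurable_id)
  have hinner : ∀ y, ∫ z, D (glue u y z) ∂πz = ∫ z, innerFun φ F u w y z := fun y =>
    integral_pi_densMeasure hφm hφp _
  -- the contribution of the derivatives in a further variable
  have hfin : ∀ i : {j // j ∉ u}, ∫⁻ p, (∫⁻ t, ‖D' i (Function.update (glue u p.1 p.2) i.1 t)‖ₑ)
      ∂(πu.prod πz) < ∞ := by
    intro i
    have hmi : Measurable fun p : (Fin s → ℝ) × ℝ => ‖D' i (Function.update p.1 i.1 p.2)‖ₑ :=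
      ((hDm _).comp (measurable_update_apply i.1)).enorm
    rw [hglue.lintegral_comp (f := fun x => ∫⁻ t, ‖D' i (Function.update x i.1 t)‖ₑ)
      hmi.lintegral_prod_right']
    have : IsProbabilityMeasure (μ i.1) := by
      simp only [hμ, dens_of_notMem hwv hvu i.2]; exact hν
    -- The old coordinate `i` carries the probability `φ` and is discarded; the new one carries
    -- Lebesgue measure, which is the weight of `i` for `insert i u`.
    have hup := measurePreserving_update (μ := μ)
      (μ' := fun j => densMeasure (dens φ ψ ω (insert i.1 u) v w j)) i.1 fun j hj => by
        simp only [hμ, dens, Finset.mem_insert, hj, false_or]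
    have hone : densMeasure (dens φ ψ ω (insert i.1 u) v w i.1) = volume := by
      rw [dens, if_neg fun h => i.2 (hvu (hwv h)), if_neg fun h => i.2 (hvu h),
        if_pos (Finset.mem_insert_self _ _), densMeasure_one]
    rw [hone] at hup
    have hlt : (insert i.1 u)ᶜ.card < n := by
      rw [← hn]
      exact Finset.card_lt_card (Finset.compl_ssubset_compl.2 (Finset.ssubset_insert i.2))
    have := ih _ hlt (hvu.trans (Finset.subset_insert _ _)) rfl
    rw [← hup.lintegral_comp (hDm _).enorm, lintegral_prod _ hmi.aemeasurable] at this
    exact this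
  have hmi : ∀ i : {j // j ∉ u}, Measurable fun p : ({j // j ∈ u} → ℝ) × ({j // j ∉ u} → ℝ) =>
      ∫⁻ t, ‖D' i (Function.update (glue u p.1 p.2) i.1 t)‖ₑ := fun i =>
    Measurable.lintegral_prod_right' (f := fun q : (({j // j ∈ u} → ℝ) × ({j // j ∉ u} → ℝ)) × ℝ =>
      ‖D' i (Function.update (glue u q.1.1 q.1.2) i.1 q.2)‖ₑ) <|
      ((hDm _).comp ((measurable_update_apply i.1).comp
        ((hglue.measurable.comp measurable_fst).prodMk measurable_snd))).enorm
  -- The Poincaré inequality on the fibre over almost every `y`.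
  have hpoin : ∀ᵐ y ∂πu, ∫⁻ z, ‖D (glue u y z)‖ₑ ∂πz ≤ ‖∫ z, innerFun φ F u w y z‖ₑ +
      ∑ i, ∫⁻ z, (∫⁻ t, ‖D' i (Function.update (glue u y z) i.1 t)‖ₑ) ∂πz := by
    have hac : πu ≪ volume := by
      rw [hπu, pi_densMeasure (d := fun j : {j // j ∈ u} => dens φ ψ ω u v w j.1)
        (fun j => measurable_dens h hψm hωm j.1) fun j t => (dens_pos h hψ hω j.1 t).le]
      exact withDensity_absolutelyContinuous _ _
    filter_upwards [hac.ae_le (hF.integrable_inner u w hu (hwv.trans hvu))] with y hy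
    have hI : Integrable (fun z => D (glue u y z)) πz :=
      (integrable_pi_densMeasure_iff hφm hφp).2 hy
    have := lintegral_enorm_le_mean_add (densMeasure φ) (f := fun z => D (glue u y z))
      (f' := fun i z => D' i (glue u y z)) ((hDm u).comp (hglue_m y))
      (fun i => (hDm _).comp (hglue_m y)) (fun i z => by
        have := hasDerivAt_mixedD_insert_left hF.hasMixedPartials (w := w) i.2 (glue u y z) (z i)
        simp only [← glue_update, Function.update_eq_self] at this
        exact this) hI
    rw [← hinner]
    simpa only [glue_update] using this
  have hDg : Measurable fun p : ({j // j ∈ u} → ℝ) × ({j // j ∉ u} → ℝ) =>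
      ‖D (glue u p.1 p.2)‖ₑ := ((hDm u).comp hglue.measurable).enorm
  rw [← hglue.lintegral_comp (hDm u).enorm, lintegral_prod _ hDg.aemeasurable]
  refine lt_of_le_of_lt (lintegral_mono_ae hpoin) ?_
  rw [lintegral_add_right _ (Finset.measurable_sum _ fun i _ => (hmi i).lintegral_prod_right'),
    lintegral_finsetSum _ fun i _ => (hmi i).lintegral_prod_right']
  refine ENNReal.add_lt_top.2 ⟨lintegral_inner_lt_top h hψm hψ hωm hω hγ hF hu hvu hwv,
    ENNReal.sum_lt_top.2 fun i _ => ?_⟩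
  have := hfin i
  rwa [lintegral_prod _ (hmi i).aemeasurable] at this

lemma integrable_mixedD_mul (h : IsDensity φ) (hψm : Measurable ψ) (hψ : ∀ x, 0 < ψ x)
    (hωm : Measurable ω) (hω : ∀ x, 0 < ω x) (hγ : ∀ u, 0 < γ u) (hF : MemSpace γ φ ψ ω F)
    {u v w : Finset (Fin s)} (hvu : v ⊆ u) (hwv : w ⊆ v) :
    Integrable fun x => mixedD (multiIndex u w) F x * ∏ j, dens φ ψ ω u v w j (x j) := by
  rw [← integrable_pi_densMeasure_iff (fun j => measurable_dens h hψm hωm j)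
    fun j t => (dens_pos h hψ hω j t).le]
  exact ⟨(measurable_mixedD hF.continuous hF.hasMixedPartials
    (multiIndex_le u w)).aestronglyMeasurable,
    lintegral_mixedD_lt_top h hψm hψ hωm hω hγ hF hvu hwv⟩

end

/-! ### Integration by parts in several variables -/

lemma prod_update_update {ι : Type*} [Fintype ι] [DecidableEq ι] (M : ι → ℝ → ℝ) (j : ι) (g : ℝ → ℝ)
    (x : ι → ℝ) (t : ℝ) :
    ∏ i, Function.update M j g i (Function.update x j t i) =
      g t * ∏ i ∈ Finset.univ.erase j, M i (x i) := by
  rw [← Finset.mul_prod_erase _ _ (Finset.mem_univ j), Function.update_self, Function.update_self]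
  congr 1
  refine Finset.prod_congr rfl fun i hi => ?_
  rw [Function.update_of_ne (Finset.ne_of_mem_erase hi),
    Function.update_of_ne (Finset.ne_of_mem_erase hi)]

/-- An integration by parts formula in one variable extends to product weights. -/
lemma integral_mul_prod_update {ι : Type*} [Fintype ι] [DecidableEq ι] (j : ι)
    {φ ψ ω g A B : ℝ → ℝ} (hφ : IsDensity φ)
    (ibp : ∀ f f' f'' : ℝ → ℝ, (∀ x, HasDerivAt f (f' x) x) → (∀ x, HasDerivAt f' (f'' x) x) →
      Integrable (fun x => f x * φ x) → Integrable f' → Integrable (fun x => f' x * ω x) →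
      Integrable (fun x => f'' x * ψ x) →
      ∫ x, f x * g x = (∫ x, f' x * A x) + ∫ x, f'' x * B x)
    {f f' f'' : (ι → ℝ) → ℝ} (M : ι → ℝ → ℝ)
    (hf : ∀ x t, HasDerivAt (fun t => f (Function.update x j t)) (f' (Function.update x j t)) t)
    (hf' : ∀ x t, HasDerivAt (fun t => f' (Function.update x j t)) (f'' (Function.update x j t)) t)
    (i0 : Integrable fun x => f x * ∏ i, Function.update M j φ i (x i))
    (i1 : Integrable fun x => f' x * ∏ i, Function.update M j (fun _ => 1) i (x i))
    (i2 : Integrable fun x => f' x * ∏ i, Function.update M j ω i (x i))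
    (i3 : Integrable fun x => f'' x * ∏ i, Function.update M j ψ i (x i))
    (ig : Integrable fun x => f x * ∏ i, Function.update M j g i (x i))
    (iA : Integrable fun x => f' x * ∏ i, Function.update M j A i (x i))
    (iB : Integrable fun x => f'' x * ∏ i, Function.update M j B i (x i)) :
    ∫ x, f x * ∏ i, Function.update M j g i (x i) =
      (∫ x, f' x * ∏ i, Function.update M j A i (x i)) +
        ∫ x, f'' x * ∏ i, Function.update M j B i (x i) := by
  have hν := hφ.isProbabilityMeasure
  -- A probability is placed on the coordinate `j` that `Function.update` overwrites, so that `∫ H`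
  -- becomes an iterated integral over `x` and `t` without splitting the index type.
  let μ : ι → Measure ℝ := Function.update (fun _ => volume) j (densMeasure φ)
  have hμj : μ j = densMeasure φ := Function.update_self ..
  have hμi : ∀ i, i ≠ j → (volume : Measure ℝ) = μ i := fun i hi => by
    simp only [μ, Function.update_of_ne hi]
  have hσ : ∀ i, SigmaFinite (μ i) := by
    intro i
    by_cases hi : i = j
    · subst hi; rw [hμj]; infer_instance
    · rw [← hμi i hi]; infer_instance
  have hp : IsProbabilityMeasure (μ j) := by rw [hμj]; exact hν
  have hup := measurePreserving_update (μ := μ) (μ' := fun _ => volume) j hμi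
  rw [← volume_pi] at hup
  have hint : ∀ {H : (ι → ℝ) → ℝ}, Integrable H →
      Integrable (fun p : (ι → ℝ) × ℝ => H (Function.update p.1 j p.2))
        ((Measure.pi μ).prod volume) := fun hH => hup.integrable_comp_of_integrable hH
  have hfub : ∀ {H : (ι → ℝ) → ℝ}, Integrable H →
      ∫ x, H x = ∫ x, (∫ t, H (Function.update x j t)) ∂(Measure.pi μ) := by
    intro H hH
    rw [← integral_prod _ (hint hH), ← hup.map_eq,
      integral_map hup.measurable.aemeasurable (by rw [hup.map_eq]; exact hH.aestronglyMeasurable)]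
  rw [hfub ig, hfub iA, hfub iB, ← integral_add (hint iA).integral_prod_left
    (hint iB).integral_prod_left]
  refine integral_congr_ae ?_
  filter_upwards [(hint i0).prod_right_ae, (hint i1).prod_right_ae, (hint i2).prod_right_ae,
    (hint i3).prod_right_ae] with x h0 h1 h2 h3
  simp only [prod_update_update, ← mul_assoc] at h0 h1 h2 h3 ⊢
  simp only [integral_mul_const]
  rw [← add_mul]
  -- If the product of the other factors vanishes, so do both sides; otherwise it can be cancelled
  -- from the integrability of the slices.
  by_cases hK : ∏ i ∈ Finset.univ.erase j, M i (x i) = 0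
  · rw [hK, mul_zero, mul_zero]
  rw [integrable_mul_const_iff (IsUnit.mk0 _ hK)] at h0 h1 h2 h3
  simp only [mul_one] at h1
  rw [ibp _ _ _ (hf x) (hf' x) h0 h1 h2 h3]

section

variable {s : ℕ} {φ ψ ω : ℝ → ℝ} {F : (Fin s → ℝ) → ℝ} {γ : Finset (Fin s) → ℝ} {C β : ℝ}

lemma integrable_mixedD_mul_prod (h : IsDensity φ) (hψm : Measurable ψ) (hψ : ∀ x, 0 < ψ x)
    (hωm : Measurable ω) (hω : ∀ x, 0 < ω x) (hγ : ∀ u, 0 < γ u) (hF : MemSpace γ φ ψ ω F)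
    {u v w : Finset (Fin s)} (hvu : v ⊆ u) (hwv : w ⊆ v) {N : Fin s → ℝ → ℝ}
    (hN : ∀ i, Measurable (N i)) (hle : ∀ i, ∃ c, ∀ x, |N i x| ≤ c * dens φ ψ ω u v w i x) :
    Integrable fun x => mixedD (multiIndex u w) F x * ∏ i, N i (x i) := by
  choose c hc using hle
  refine integrable_mul_of_abs_le (c := ∏ i, c i)
    (integrable_mixedD_mul h hψm hψ hωm hω hγ hF hvu hwv)
    (measurable_mixedD hF.continuous hF.hasMixedPartials (multiIndex_le u w)).aestronglyMeasurable
    (measurable_prod_apply hN).aestronglyMeasurable fun x => ?_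
  rw [Finset.abs_prod, ← Finset.prod_mul_distrib]
  exact Finset.prod_le_prod (fun _ _ => abs_nonneg _) fun i _ => hc i _

/-- The factors after integration by parts in the variables of `t`, where `w` holds the variables
in which two derivatives fall on the function. -/
def factor (φ : ℝ → ℝ) (k : Fin s → ℕ) (t w : Finset (Fin s)) (j : Fin s) : ℝ → ℝ :=
  if j ∈ w then ker₂ φ (k j) else if j ∈ t then ker₁ φ (k j)
  else fun x => wal (k j) (cdf φ x) * φ x

/-- The coordinates of `k` with at least two binary digits `1`. -/
def multiBit (k : Fin s → ℕ) : Finset (Fin s) := {j | k j ≠ 0 ∧ k j ≠ 2 ^ Nat.log 2 (k j)}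

lemma measurable_factor (h : IsDensity φ) (k : Fin s → ℕ) (t w : Finset (Fin s)) (j : Fin s) :
    Measurable (factor φ k t w j) := by
  unfold factor
  split_ifs
  exacts [measurable_ker₂ h _, measurable_ker₁ h _,
    ((measurable_wal _).comp h.continuous_cdf.measurable).mul h.measurable]

/-- With `v` the multi-digit variables in `t`, every factor is dominated by the norm weight of its
variable. The constant is `C` for multi-digit and `1` for single-digit indices, and `2 max(C, 1/2)`
exceeds both. -/
lemma abs_factor_le (h : IsDensity φ) (hψ : ∀ x, 0 < ψ x)
    (hω : ∀ x, 0 < ω x) (hA : AssumptionA φ ψ ω C β) {k : Fin s → ℕ} {t w : Finset (Fin s)}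
    (htk : ∀ j ∈ t, k j ≠ 0) (hw : w ⊆ multiBit k ∩ t) (j : Fin s) (x : ℝ) :
    |factor φ k t w j x| ≤ (if j ∈ t then 2 * max C (1 / 2) * (1 / 2 ^ mu β (k j)) else 1) *
      dens φ ψ ω t (multiBit k ∩ t) w j x := by
  have hC0 : (1 : ℝ) ≤ 2 * max C (1 / 2) := by linarith [le_max_right C (1 / 2)]
  have hC1 : C ≤ 2 * max C (1 / 2) := by linarith [le_max_left C (1 / 2), le_max_right C (1 / 2)]
  have hmu : (0 : ℝ) < 1 / 2 ^ mu β (k j) := by positivity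
  unfold factor dens
  by_cases hjt : j ∈ t
  · have hk0 := htk j hjt
    simp only [if_pos hjt]
    by_cases hjw : j ∈ w
    · have hm : k j ≠ 2 ^ Nat.log 2 (k j) := by
        have := Finset.mem_of_mem_inter_left (hw hjw)
        exact (Finset.mem_filter.1 this).2.2
      rw [if_pos hjw, if_pos hjw]
      refine (abs_ker₂_le h hψ hA hk0 hm x).trans ?_
      have := (hψ x).le
      gcongr
    · rw [if_neg hjw, if_neg hjw]
      by_cases hm : k j = 2 ^ Nat.log 2 (k j)
      · have : j ∉ multiBit k ∩ t := fun h =>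
          (Finset.mem_filter.1 (Finset.mem_of_mem_inter_left h)).2.2 hm
        rw [if_neg this, mul_one]
        exact (abs_ker₁_two_pow_le h β hm x).trans (le_mul_of_one_le_left hmu.le hC0)
      · have : j ∈ multiBit k ∩ t :=
          Finset.mem_inter.2 ⟨Finset.mem_filter.2 ⟨Finset.mem_univ _, hk0, hm⟩, hjt⟩
        rw [if_pos this]
        refine (abs_ker₁_le h hω hA hk0 hm x).trans ?_
        have := (hω x).le
        gcongr
  · have h1 : j ∉ multiBit k ∩ t := fun h => hjt (Finset.mem_of_mem_inter_right h)
    have h2 : j ∉ w := fun h => h1 (hw h)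
    rw [if_neg h2, if_neg h2, if_neg hjt, if_neg h1, if_neg hjt, if_neg hjt, abs_mul, abs_wal,
      abs_of_pos (h.pos x)]

/-- Single-digit indices have `ker₂ = 0`. Such terms are kept in the expansion so that it runs over
all `w ⊆ t`. -/
lemma prod_factor_eq_zero {k : Fin s → ℕ} {t w : Finset (Fin s)} (htk : ∀ j ∈ t, k j ≠ 0)
    (hwt : w ⊆ t) (hw : ¬w ⊆ multiBit k) (x : Fin s → ℝ) : ∏ j, factor φ k t w j (x j) = 0 := by
  obtain ⟨j, hjw, hj⟩ := Finset.not_subset.1 hw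
  refine Finset.prod_eq_zero (Finset.mem_univ j) ?_
  have : k j = 2 ^ Nat.log 2 (k j) := by
    by_contra hne
    exact hj (Finset.mem_filter.2 ⟨Finset.mem_univ _, htk j (hwt hjw), hne⟩)
  rw [factor, if_pos hjw, ker₂, if_pos this]

lemma integrable_mixedD_mul_factor (h : IsDensity φ) (hψm : Measurable ψ) (hψ : ∀ x, 0 < ψ x)
    (hωm : Measurable ω) (hω : ∀ x, 0 < ω x) (hA : AssumptionA φ ψ ω C β) (hγ : ∀ u, 0 < γ u)
    (hF : MemSpace γ φ ψ ω F) {k : Fin s → ℕ} {t w : Finset (Fin s)} (htk : ∀ j ∈ t, k j ≠ 0)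
    (hwt : w ⊆ t) :
    Integrable fun x => mixedD (multiIndex t w) F x * ∏ j, factor φ k t w j (x j) := by
  by_cases hw : w ⊆ multiBit k
  · exact integrable_mixedD_mul_prod h hψm hψ hωm hω hγ hF Finset.inter_subset_right
      (Finset.subset_inter hw hwt) (measurable_factor h k t w)
      fun i => ⟨_, abs_factor_le h hψ hω hA htk (Finset.subset_inter hw hwt) i⟩
  · simp [prod_factor_eq_zero htk hwt hw]

/-- Integration by parts in one further variable. -/
lemma integral_mixedD_mul_factor (h : IsDensity φ) (hψm : Measurable ψ) (hψ : ∀ x, 0 < ψ x)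
    (hωm : Measurable ω) (hω : ∀ x, 0 < ω x) (hA : AssumptionA φ ψ ω C β) (hγ : ∀ u, 0 < γ u)
    (hF : MemSpace γ φ ψ ω F) {k : Fin s → ℕ} {t w : Finset (Fin s)} {j : Fin s} (hj : j ∉ t)
    (htk : ∀ i ∈ insert j t, k i ≠ 0) (hwt : w ⊆ t) :
    ∫ x, mixedD (multiIndex t w) F x * ∏ i, factor φ k t w i (x i) =
      (∫ x, mixedD (multiIndex (insert j t) w) F x * ∏ i, factor φ k (insert j t) w i (x i)) +
      ∫ x, mixedD (multiIndex (insert j t) (insert j w)) F x *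
        ∏ i, factor φ k (insert j t) (insert j w) i (x i) := by
  have htk' : ∀ i ∈ t, k i ≠ 0 := fun i hi => htk i (Finset.mem_insert_of_mem hi)
  have hwt' : w ⊆ insert j t := hwt.trans (Finset.subset_insert _ _)
  have hwt'' : insert j w ⊆ insert j t := Finset.insert_subset_insert _ hwt
  by_cases hw : w ⊆ multiBit k
  swap
  · have hw' : ¬insert j w ⊆ multiBit k := fun h => hw ((Finset.subset_insert _ _).trans h)
    simp only [prod_factor_eq_zero htk' hwt hw, prod_factor_eq_zero htk hwt' hw,
      prod_factor_eq_zero htk hwt'' hw', mul_zero, integral_zero, add_zero]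
  have hjw : j ∉ w := fun h => hj (hwt h)
  set M := factor φ k t w with hM
  -- The three products differ in the factor at `j` only.
  have e0 : M = Function.update M j fun x => wal (k j) (cdf φ x) * φ x := by
    rw [eq_comm, Function.update_eq_self_iff, hM, factor, if_neg hjw, if_neg hj]
  have e1 : factor φ k (insert j t) w = Function.update M j (ker₁ φ (k j)) := by
    funext i
    by_cases hi : i = j
    · subst hi; simp [factor, hjw]
    · simp [factor, hM, hi]
  have e2 : factor φ k (insert j t) (insert j w) = Function.update M j (ker₂ φ (k j)) := by
    funext i
    by_cases hi : i = j
    · subst hi; simp [factor]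
    · simp [factor, hM, hi]
  have hMm : ∀ d : ℝ → ℝ, Measurable d → ∀ i, Measurable (Function.update M j d i) := by
    intro d hd i
    by_cases hi : i = j
    · subst hi; simpa using hd
    · rw [Function.update_of_ne hi]; exact measurable_factor h k t w i
  have hbound : ∀ (d : ℝ → ℝ) (u' v' w' : Finset (Fin s)), (∀ x, 0 ≤ d x) →
      dens φ ψ ω u' v' w' j = d →
      (∀ i, i ≠ j → dens φ ψ ω u' v' w' i = dens φ ψ ω t (multiBit k ∩ t) w i) →
      ∀ i, ∃ c, ∀ x, |Function.update M j d i x| ≤ c * dens φ ψ ω u' v' w' i x := by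
    intro d u' v' w' hd0 hd hoff i
    by_cases hi : i = j
    · subst hi
      refine ⟨1, fun x => ?_⟩
      rw [Function.update_self, hd, one_mul, abs_of_nonneg (hd0 x)]
    · rw [hoff i hi, Function.update_of_ne hi]
      exact ⟨_, abs_factor_le h hψ hω hA htk' (Finset.subset_inter hw hwt) i⟩
  have hsub : w ⊆ multiBit k ∩ t := Finset.subset_inter hw hwt
  have hjm : j ∉ multiBit k ∩ t := fun h => hj (Finset.mem_of_mem_inter_right h)
  have hmt : multiBit k ∩ t ⊆ insert j t :=
    Finset.inter_subset_right.trans (Finset.subset_insert _ _)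
  have hmt' : insert j (multiBit k ∩ t) ⊆ insert j t :=
    Finset.insert_subset_insert _ Finset.inter_subset_right
  have ig := integrable_mixedD_mul_factor h hψm hψ hωm hω hA hγ hF htk' hwt
  have iA := integrable_mixedD_mul_factor h hψm hψ hωm hω hA hγ hF htk hwt'
  have iB := integrable_mixedD_mul_factor h hψm hψ hωm hω hA hγ hF htk hwt''
  rw [← hM, e0] at ig
  rw [e1] at iA
  rw [e2] at iB
  rw [e1, e2, e0, Function.update_idem, Function.update_idem]
  refine integral_mul_prod_update j h (fun f f' f'' hf hf' => integral_mul_wal_eq_ker h hψ hω hA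
    (htk j (Finset.mem_insert_self _ _)) hf hf') M
    (hasDerivAt_mixedD_insert_left hF.hasMixedPartials hj)
    (hasDerivAt_mixedD_insert_right hF.hasMixedPartials hjw) ?_ ?_ ?_ ?_ ig iA iB
  -- The four integrability conditions come from different `(u, v, w)`: `j` outside `u` gives weight
  -- `φ`, `j ∈ u \ v` weight `1`, `j ∈ v \ w` weight `ω`, and `j ∈ w` weight `ψ`. The norm covers
  -- all of them because it is a maximum over every `v ⊆ u`.
  · refine integrable_mixedD_mul_prod h hψm hψ hωm hω hγ hF Finset.inter_subset_right hsub
      (hMm φ h.measurable) (hbound φ _ _ _ (fun x => (h.pos x).le) ?_ fun i hi => rfl)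
    rw [dens, if_neg hjw, if_neg hjm, if_neg hj]
  · refine integrable_mixedD_mul_prod h hψm hψ hωm hω hγ hF hmt hsub
      (hMm _ measurable_const) (hbound _ _ _ _ (fun x => zero_le_one) ?_ fun i hi => ?_)
    · rw [dens, if_neg hjw, if_neg hjm, if_pos (Finset.mem_insert_self _ _)]
    · simp [dens, hi]
  · refine integrable_mixedD_mul_prod h hψm hψ hωm hω hγ hF hmt'
      (hsub.trans (Finset.subset_insert _ _))
      (hMm _ hωm) (hbound _ _ _ _ (fun x => (hω x).le) ?_ fun i hi => ?_)
    · rw [dens, if_neg hjw, if_pos (Finset.mem_insert_self _ _)]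
    · simp [dens, hi]
  · refine integrable_mixedD_mul_prod h hψm hψ hωm hω hγ hF hmt'
      (Finset.insert_subset_insert _ hsub)
      (hMm _ hψm) (hbound _ _ _ _ (fun x => (hψ x).le) ?_ fun i hi => ?_)
    · rw [dens, if_pos (Finset.mem_insert_self _ _)]
    · simp [dens, hi]

/-- The Walsh coefficient of `F ∘ Φ⁻¹`. -/
def walCoeff (φ : ℝ → ℝ) (F : (Fin s → ℝ) → ℝ) (k : Fin s → ℕ) : ℝ :=
  ∫ x, F x * ∏ j, wal (k j) (cdf φ (x j)) * φ (x j)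

/-- Each further variable splits the term `w` into the terms `w` and `insert j w`, matching the
subsets of `insert j t`. -/
lemma walCoeff_eq_sum (h : IsDensity φ) (hψm : Measurable ψ) (hψ : ∀ x, 0 < ψ x)
    (hωm : Measurable ω) (hω : ∀ x, 0 < ω x) (hA : AssumptionA φ ψ ω C β) (hγ : ∀ u, 0 < γ u)
    (hF : MemSpace γ φ ψ ω F) {k : Fin s → ℕ} {t : Finset (Fin s)} (htk : ∀ j ∈ t, k j ≠ 0) :
    walCoeff φ F k = ∑ w ∈ t.powerset,
      ∫ x, mixedD (multiIndex t w) F x * ∏ j, factor φ k t w j (x j) := by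
  induction t using Finset.induction_on with
  | empty =>
    rw [Finset.powerset_empty, Finset.sum_singleton, mixedD_multiIndex_empty]
    simp [walCoeff, factor]
  | insert j t hj ih =>
    rw [ih fun i hi => htk i (Finset.mem_insert_of_mem hi), Finset.sum_powerset_insert hj,
      ← Finset.sum_add_distrib]
    exact Finset.sum_congr rfl fun w hw =>
      integral_mixedD_mul_factor h hψm hψ hωm hω hA hγ hF hj htk (Finset.mem_powerset.1 hw)

end

/-! ### Decay of the Walsh coefficients -/

section

variable {s : ℕ} {φ ψ ω : ℝ → ℝ} {F : (Fin s → ℝ) → ℝ} {γ : Finset (Fin s) → ℝ} {C β : ℝ}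

/-- The coordinates in which `k` does not vanish. -/
def supp (k : Fin s → ℕ) : Finset (Fin s) := {j | k j ≠ 0}

lemma mem_supp {k : Fin s → ℕ} {j : Fin s} : j ∈ supp k ↔ k j ≠ 0 := by simp [supp]

lemma multiBit_subset_supp (k : Fin s → ℕ) : multiBit k ⊆ supp k := fun _ hj =>
  mem_supp.2 (Finset.mem_filter.1 hj).2.1

lemma factor_of_notMem_supp (φ : ℝ → ℝ) {k : Fin s → ℕ} {w : Finset (Fin s)} (hw : w ⊆ supp k)
    {j : Fin s} (hj : j ∉ supp k) : factor φ k (supp k) w j = φ := by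
  have : k j = 0 := by simpa [mem_supp] using hj
  rw [factor, if_neg fun h => hj (hw h), if_neg hj, this]
  simp

lemma integral_eq_integral_glue (u : Finset (Fin s)) {H : (Fin s → ℝ) → ℝ} (hH : Integrable H) :
    ∫ x, H x = ∫ y : {j // j ∈ u} → ℝ, ∫ z : {j // j ∉ u} → ℝ, H (glue u y z) := by
  have hg := measurePreserving_glue u fun _ => (volume : Measure ℝ)
  simp only [← volume_pi] at hg
  have hi : Integrable (fun p : ({j // j ∈ u} → ℝ) × ({j // j ∉ u} → ℝ) => H (glue u p.1 p.2))
      (volume.prod volume) := hg.integrable_comp_of_integrable hH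
  rw [← integral_prod _ hi, ← hg.map_eq, integral_map hg.measurable.aemeasurable
    (by rw [hg.map_eq]; exact hH.aestronglyMeasurable)]

/-- Off the support the factors are just `φ`. Integrating those variables first, before taking
absolute values, produces the inner integral of the norm. -/
lemma enorm_integral_factor_le (h : IsDensity φ) (hψm : Measurable ψ) (hψ : ∀ x, 0 < ψ x)
    (hωm : Measurable ω) (hω : ∀ x, 0 < ω x) (hA : AssumptionA φ ψ ω C β) (hγ : ∀ u, 0 < γ u)
    (hF : MemSpace γ φ ψ ω F) (k : Fin s → ℕ) {w : Finset (Fin s)} (hw : w ⊆ multiBit k) :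
    ‖∫ x, mixedD (multiIndex (supp k) w) F x * ∏ j, factor φ k (supp k) w j (x j)‖ₑ ≤
      ENNReal.ofReal (∏ j : {j // j ∈ supp k}, (2 * max C (1 / 2) * (1 / 2 ^ mu β (k j)))) *
        ∫⁻ y : {j // j ∈ supp k} → ℝ,
          ENNReal.ofReal (|∫ z : {j // j ∉ supp k} → ℝ, innerFun φ F (supp k) w y z| *
            normWeight ψ ω (supp k) (multiBit k) w y) := by
  have hsk : ∀ j ∈ supp k, k j ≠ 0 := fun j hj => mem_supp.1 hj
  have hws : w ⊆ supp k := hw.trans (multiBit_subset_supp k)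
  have hinter : multiBit k ∩ supp k = multiBit k :=
    Finset.inter_eq_left.2 (multiBit_subset_supp k)
  rw [integral_eq_integral_glue (supp k)
    (integrable_mixedD_mul_factor h hψm hψ hωm hω hA hγ hF hsk hws),
    ← lintegral_const_mul' _ _ ENNReal.ofReal_ne_top]
  refine (enorm_integral_le_lintegral_enorm _).trans (lintegral_mono fun y => ?_)
  have e : ∀ z : {j // j ∉ supp k} → ℝ,
      mixedD (multiIndex (supp k) w) F (glue (supp k) y z) *
        ∏ j, factor φ k (supp k) w j (glue (supp k) y z j) =
      (∏ j : {j // j ∈ supp k}, factor φ k (supp k) w j (y j)) *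
        innerFun φ F (supp k) w y z := by
    intro z
    have h1 := Fintype.prod_subtype_mul_prod_subtype (· ∈ supp k)
      fun j => factor φ k (supp k) w j (glue (supp k) y z j)
    have h2 : ∏ j : {j // j ∉ supp k}, factor φ k (supp k) w j (glue (supp k) y z j) =
        ∏ j, φ (z j) := by
      refine Finset.prod_congr rfl fun j _ => ?_
      rw [factor_of_notMem_supp φ hws j.2]
      simp [glue, j.2]
    have h3 : ∏ j : {j // j ∈ supp k}, factor φ k (supp k) w j (glue (supp k) y z j) =
        ∏ j : {j // j ∈ supp k}, factor φ k (supp k) w j (y j) :=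
      Finset.prod_congr rfl fun j _ => by simp [glue, j.2]
    rw [← h1, h2, innerFun, ← h3]
    convert mul_left_comm _ _ _
  simp only [e]
  rw [integral_const_mul, enorm_mul, Real.enorm_eq_ofReal_abs, Real.enorm_eq_ofReal_abs,
    ENNReal.ofReal_mul (abs_nonneg _), mul_comm (ENNReal.ofReal |∫ z, _|), ← mul_assoc,
    ← ENNReal.ofReal_mul (Finset.prod_nonneg fun j _ => by
      have := le_max_right C (1 / 2); positivity)]
  gcongr
  rw [normWeight_eq (φ := φ), Finset.abs_prod, ← Finset.prod_mul_distrib]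
  refine Finset.prod_le_prod (fun _ _ => abs_nonneg _) fun j _ => ?_
  have := abs_factor_le h hψ hω hA hsk (hinter.symm ▸ hw) j.1 (y j)
  rwa [if_pos j.2, hinter] at this

lemma prod_const_mul_eq (k : Fin s → ℕ) :
    ∏ j : {j // j ∈ supp k}, (2 * max C (1 / 2) * (1 / (2 : ℝ) ^ mu β (k j))) =
      (2 * max C (1 / 2)) ^ (supp k).card *
        (1 / (2 : ℝ) ^ (∑ j : {j // j ∈ supp k}, mu β (k j))) := by
  rw [Finset.prod_mul_distrib, Finset.prod_const, Finset.card_univ, Fintype.card_coe,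
    Finset.prod_div_distrib, Finset.prod_const_one, Real.rpow_sum_of_pos two_pos]

/-- Only `w ⊆ multiBit k` contribute, and their weighted integrals add up to `‖F‖_{u,v}` with `v =
multiBit k`; no factor for the number of subsets is lost. -/
lemma enorm_walCoeff_le (h : IsDensity φ) (hψm : Measurable ψ) (hψ : ∀ x, 0 < ψ x)
    (hωm : Measurable ω) (hω : ∀ x, 0 < ω x) (hA : AssumptionA φ ψ ω C β) (hγ : ∀ u, 0 < γ u)
    (hF : MemSpace γ φ ψ ω F) {k : Fin s → ℕ} (hk : (supp k).Nonempty) :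
    ‖walCoeff φ F k‖ₑ ≤ wNorm γ φ ψ ω F *
      (ENNReal.ofReal (γ (supp k) * (2 * max C (1 / 2)) ^ (supp k).card) *
        ENNReal.ofReal (1 / (2 : ℝ) ^ (∑ j : {j // j ∈ supp k}, mu β (k j)))) := by
  have hC : 0 ≤ 2 * max C (1 / 2) := by have := le_max_right C (1 / 2); positivity
  have hsub := Finset.powerset_mono.2 (multiBit_subset_supp k)
  have hzero : ∀ w ∈ (supp k).powerset, w ∉ (multiBit k).powerset →
      ∫ x, mixedD (multiIndex (supp k) w) F x * ∏ j, factor φ k (supp k) w j (x j) = 0 := by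
    intro w hw hw'
    simp only [prod_factor_eq_zero (fun j hj => mem_supp.1 hj) (Finset.mem_powerset.1 hw)
      (fun hc => hw' (Finset.mem_powerset.2 hc)), mul_zero, integral_zero]
  rw [walCoeff_eq_sum h hψm hψ hωm hω hA hγ hF fun j hj => mem_supp.1 hj,
    ← Finset.sum_subset hsub hzero]
  refine (enorm_sum_le _ _).trans ((Finset.sum_le_sum fun w hw => enorm_integral_factor_le h hψm hψ
    hωm hω hA hγ hF k (Finset.mem_powerset.1 hw)).trans ?_)
  rw [← Finset.mul_sum]
  refine (mul_le_mul_right (normUV_le hγ hk (multiBit_subset_supp k)) _).trans (le_of_eq ?_)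
  rw [prod_const_mul_eq, ENNReal.ofReal_mul (pow_nonneg hC _), ENNReal.ofReal_mul (hγ _).le]
  ring

end

/-! ### Pointwise convergence of the Walsh series -/

section

variable {s : ℕ} {φ : ℝ → ℝ} {F : (Fin s → ℝ) → ℝ}

/-- The Dirichlet kernel in one variable. -/
def dirichlet (n : ℕ) (p q : ℝ) : ℝ := ∑ k ∈ Finset.range (2 ^ n), wal k p * wal k q

lemma measurable_dirichlet (n : ℕ) (q : ℝ) : Measurable fun p => dirichlet n p q :=
  Finset.measurable_sum _ fun k _ => (measurable_wal k).mul_const _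

lemma integrable_wal_cdf (h : IsDensity φ) (k : ℕ) :
    Integrable fun t => wal k (cdf φ t) * φ t := by
  refine h.integrable.mono (((measurable_wal k).comp h.continuous_cdf.measurable).mul
    h.measurable).aestronglyMeasurable (Eventually.of_forall fun t => ?_)
  simp [abs_wal]

lemma integral_dirichlet (h : IsDensity φ) (n : ℕ) (q : ℝ) :
    ∫ t, dirichlet n (cdf φ t) q * φ t = 1 := by
  have e : ∀ t, dirichlet n (cdf φ t) q * φ t =
      ∑ k ∈ Finset.range (2 ^ n), wal k q * (wal k (cdf φ t) * φ t) := by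
    intro t
    rw [dirichlet, Finset.sum_mul]
    exact Finset.sum_congr rfl fun k _ => by ring
  simp only [e]
  rw [integral_finsetSum _ fun k _ => (integrable_wal_cdf h k).const_mul _]
  simp only [integral_const_mul]
  rw [Finset.sum_eq_single 0]
  · simp [h.integral_eq_one]
  · intro k _ hk
    rw [h.integral_wal_cdf hk, mul_zero]
  · intro h0
    exact absurd (Finset.mem_range.2 (by positivity)) h0

lemma sum_walCoeff_eq (h : IsDensity φ) (hc : Measurable F)
    (hF : Integrable fun x => F x * ∏ j, φ (x j)) (n : ℕ) (p : Fin s → ℝ) :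
    ∑ k ∈ Fintype.piFinset fun _ : Fin s => Finset.range (2 ^ n),
        walCoeff φ F k * ∏ j, wal (k j) (p j) =
      ∫ x, F x * ∏ j, dirichlet n (cdf φ (x j)) (p j) * φ (x j) := by
  have hi : ∀ k : Fin s → ℕ, Integrable fun x : Fin s → ℝ =>
      F x * ∏ j, wal (k j) (cdf φ (x j)) * φ (x j) := by
    intro k
    refine integrable_mul_of_abs_le (c := 1) hF hc.aestronglyMeasurable
      (measurable_prod_apply fun j => ((measurable_wal (k j)).comp
        h.continuous_cdf.measurable).mul h.measurable).aestronglyMeasurable fun x => ?_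
    rw [Finset.abs_prod, one_mul]
    refine Finset.prod_le_prod (fun _ _ => abs_nonneg _) fun j _ => ?_
    rw [abs_mul, abs_wal, one_mul, abs_of_pos (h.pos _)]
  simp only [walCoeff, ← integral_mul_const]
  rw [← integral_finsetSum _ fun k _ => (hi k).mul_const _]
  refine integral_congr_ae (Eventually.of_forall fun x => ?_)
  simp only [mul_assoc, ← Finset.mul_sum]
  congr 1
  simp only [dirichlet, Finset.sum_mul]
  rw [Finset.prod_univ_sum]
  refine Finset.sum_congr rfl fun k _ => ?_
  rw [← Finset.prod_mul_distrib]
  exact Finset.prod_congr rfl fun j _ => by ring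

/-- Points with the same first `n` digits differ by less than `2^(-n)`, eventually below the
increments of `Φ` on both sides of `x₀`. -/
lemma eventually_abs_sub_lt (h : IsDensity φ) (x₀ : ℝ) {δ : ℝ} (hδ : 0 < δ) :
    ∀ᶠ n : ℕ in atTop, ∀ t, ⌊(2 : ℝ) ^ n * cdf φ t⌋₊ = ⌊(2 : ℝ) ^ n * cdf φ x₀⌋₊ →
      |t - x₀| < δ := by
  have h1 : 0 < cdf φ (x₀ + δ) - cdf φ x₀ := sub_pos.2 (h.strictMono_cdf (by linarith))
  have h2 : 0 < cdf φ x₀ - cdf φ (x₀ - δ) := sub_pos.2 (h.strictMono_cdf (by linarith))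
  have hlim : Tendsto (fun n : ℕ => (1 / 2 : ℝ) ^ n) atTop (𝓝 0) :=
    tendsto_pow_atTop_nhds_zero_of_lt_one (by norm_num) (by norm_num)
  filter_upwards [hlim.eventually_lt_const h1, hlim.eventually_lt_const h2] with n hn1 hn2 t ht
  rw [one_div, inv_pow, ← one_div] at hn1 hn2
  have a1 := floor_div_le (n := n) (h.cdf_pos t).le
  have a2 := lt_floor_add_one_div n (cdf φ t)
  have a3 := floor_div_le (n := n) (h.cdf_pos x₀).le
  have a4 := lt_floor_add_one_div n (cdf φ x₀)
  rw [ht] at a1 a2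
  rw [add_div] at a2 a4
  rw [abs_sub_lt_iff]
  constructor
  · have := h.strictMono_cdf.lt_iff_lt.1 (show cdf φ t < cdf φ (x₀ + δ) by linarith)
    linarith
  · have := h.strictMono_cdf.lt_iff_lt.1 (show cdf φ (x₀ - δ) < cdf φ t by linarith)
    linarith

/-- The partial sum averages `F` against a nonnegative kernel of integral one, supported in a box
around the point that shrinks to it. Continuity there suffices, whatever the growth of `F`. -/
lemma tendsto_sum_walCoeff (h : IsDensity φ) (hc : Continuous F)
    (hF : Integrable fun x => F x * ∏ j, φ (x j)) {p : Fin s → ℝ} (hp : ∀ j, p j ∈ Ioo (0 : ℝ) 1) :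
    Tendsto (fun n : ℕ => ∑ k ∈ Fintype.piFinset fun _ : Fin s => Finset.range (2 ^ n),
      walCoeff φ F k * ∏ j, wal (k j) (p j)) atTop (𝓝 (F fun j => invCdf φ (p j))) := by
  set x₀ : Fin s → ℝ := fun j => invCdf φ (p j) with hx₀
  have hpx : ∀ j, p j = cdf φ (x₀ j) := fun j => (h.cdf_invCdf (hp j)).symm
  rw [Metric.tendsto_atTop']
  intro ε hε
  obtain ⟨δ, hδ, hcont⟩ := Metric.continuousAt_iff.1 (hc.continuousAt (x := x₀)) (ε / 2) (half_pos hε)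
  obtain ⟨N, hN⟩ := eventually_atTop.1
    (eventually_all.2 fun j => eventually_abs_sub_lt h (x₀ j) hδ)
  refine ⟨N, fun n hn => ?_⟩
  rw [sum_walCoeff_eq h hc.measurable hF]
  set K : (Fin s → ℝ) → ℝ := fun x => ∏ j, dirichlet n (cdf φ (x j)) (p j) * φ (x j) with hK
  have hd : ∀ t j, dirichlet n (cdf φ t) (p j) =
      if ⌊(2 : ℝ) ^ n * cdf φ t⌋₊ = ⌊(2 : ℝ) ^ n * cdf φ (x₀ j)⌋₊ then 2 ^ n else 0 := by
    intro t j
    rw [hpx]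
    exact sum_wal_mul_wal n ⟨(h.cdf_pos _).le, h.cdf_lt_one _⟩ ⟨(h.cdf_pos _).le, h.cdf_lt_one _⟩
  have hd0 : ∀ t j, 0 ≤ dirichlet n (cdf φ t) (p j) ∧ dirichlet n (cdf φ t) (p j) ≤ 2 ^ n := by
    intro t j
    rw [hd]
    split_ifs
    exacts [⟨by positivity, le_rfl⟩, ⟨le_rfl, by positivity⟩]
  have hK0 : ∀ x, 0 ≤ K x := fun x => Finset.prod_nonneg fun j _ =>
    mul_nonneg (hd0 _ _).1 (h.pos _).le
  have hKm : Measurable K := measurable_prod_apply fun j =>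
    ((measurable_dirichlet n (p j)).comp h.continuous_cdf.measurable).mul h.measurable
  have hKle : ∀ x, |K x| ≤ (∏ _j : Fin s, (2 : ℝ) ^ n) * ∏ j, φ (x j) := by
    intro x
    rw [abs_of_nonneg (hK0 x), ← Finset.prod_mul_distrib]
    exact Finset.prod_le_prod (fun j _ => mul_nonneg (hd0 _ _).1 (h.pos _).le) fun j _ =>
      mul_le_mul_of_nonneg_right (hd0 _ _).2 (h.pos _).le
  have hKi : Integrable K := by
    have hφi : Integrable fun x : Fin s → ℝ => ∏ j, φ (x j) :=
      Integrable.fintype_prod fun _ => h.integrable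
    refine (hφi.const_mul _).mono' hKm.aestronglyMeasurable (Eventually.of_forall hKle)
  have hFK : Integrable fun x => F x * K x :=
    integrable_mul_of_abs_le hF hc.measurable.aestronglyMeasurable hKm.aestronglyMeasurable hKle
  have hK1 : ∫ x, K x = 1 := by
    rw [hK, integral_fintype_prod_volume_eq_prod fun j t => dirichlet n (cdf φ t) (p j) * φ t]
    exact Finset.prod_eq_one fun j _ => integral_dirichlet h n (p j)
  have hsub : (∫ x, F x * K x) - F x₀ = ∫ x, (F x - F x₀) * K x := by
    simp only [sub_mul]
    rw [integral_sub hFK (hKi.const_mul _), integral_const_mul, hK1, mul_one]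
  rw [Real.dist_eq, hsub, ← Real.norm_eq_abs]
  refine lt_of_le_of_lt (norm_integral_le_of_norm_le (hKi.const_mul (ε / 2))
    (Eventually.of_forall fun x => ?_)) ?_
  · rw [norm_mul, Real.norm_of_nonneg (hK0 x)]
    by_cases hx : ∀ j, ⌊(2 : ℝ) ^ n * cdf φ (x j)⌋₊ = ⌊(2 : ℝ) ^ n * cdf φ (x₀ j)⌋₊
    · refine mul_le_mul_of_nonneg_right (le_of_lt (hcont ?_)) (hK0 x)
      rw [dist_pi_lt_iff hδ]
      exact fun j => hN n hn.le j _ (hx j)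
    · push Not at hx
      obtain ⟨j, hj⟩ := hx
      have : K x = 0 := Finset.prod_eq_zero (Finset.mem_univ j) (by rw [hd, if_neg hj, zero_mul])
      rw [this, mul_zero, mul_zero]
  · rw [integral_const_mul, hK1, mul_one]
    exact half_lt_self hε

end

/-! ### Summability -/

/-- With `q = 2^(-β)`, the dyadic block at level `i` contributes `(2q)^i`, and `2q ≥ 1` because `β ≤
1`, so each of the `n` blocks is at most `(2q)^n`. -/
lemma sum_rpow_log_le {β : ℝ} (hβ1 : β ≤ 1) (n : ℕ) :
    ∑ l ∈ Finset.range (2 ^ n), (if l = 0 then 0 else ((2 : ℝ) ^ (-β)) ^ Nat.log 2 l) ≤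
      n * (2 * (2 : ℝ) ^ (-β)) ^ n := by
  set q : ℝ := (2 : ℝ) ^ (-β) with hq
  have hq0 : 0 < q := by positivity
  have hq1 : 1 ≤ 2 * q := by
    have : (2 : ℝ) * q = 2 ^ (1 - β) := by
      rw [hq, sub_eq_add_neg, Real.rpow_add two_pos, Real.rpow_one]
    rw [this]
    exact Real.one_le_rpow one_le_two (by linarith)
  induction n with
  | zero => simp
  | succ n ih =>
    rw [pow_succ, mul_two, Finset.sum_range_add]
    have e : ∑ l ∈ Finset.range (2 ^ n),
        (if 2 ^ n + l = 0 then 0 else q ^ Nat.log 2 (2 ^ n + l)) = (2 * q) ^ n := by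
      rw [Finset.sum_congr rfl (g := fun _ => q ^ n)]
      · simp [mul_pow]
      · intro l hl
        rw [if_neg (by positivity), log_two_pow_add (Finset.mem_range.1 hl)]
    rw [e]
    have : (2 * q) ^ n ≤ (2 * q) ^ (n + 1) := pow_le_pow_right₀ hq1 (Nat.le_succ n)
    push_cast
    calc _ ≤ n * (2 * q) ^ n + (2 * q) ^ n := by gcongr
      _ = (n + 1) * (2 * q) ^ n := by ring
      _ ≤ _ := by gcongr

lemma one_div_two_rpow_mu {β : ℝ} {n l : ℕ} (hl : l < 2 ^ n) :
    1 / (2 : ℝ) ^ mu β (2 ^ n + l) = (1 / 2) ^ n *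
      ((if l = 0 then 1 else 0) + if l = 0 then 0 else ((2 : ℝ) ^ (-β)) ^ Nat.log 2 l) := by
  have h0 : 2 ^ n + l ≠ 0 := by positivity
  by_cases hl0 : l = 0
  · subst hl0
    simp [mu_two_pow]
  · have hne : 2 ^ n + l ≠ 2 ^ Nat.log 2 (2 ^ n + l) := by
      rw [log_two_pow_add hl]; omega
    rw [mu, if_neg h0, if_neg hne, log_two_pow_add hl, Nat.add_sub_cancel_left, if_neg hl0,
      if_neg hl0, zero_add, Real.rpow_add two_pos, Real.rpow_natCast, one_div, mul_inv,
      ← Real.rpow_neg two_pos.le, ← neg_mul, Real.rpow_mul_natCast two_pos.le, one_div, inv_pow]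

/-- The block `[2^n, 2^(n+1))` contributes at most `2^(-n) (1 + n (2q)^n) = 2^(-n) + n q^n`, where
`q = 2^(-β) < 1` because `β > 0`. -/
lemma summable_one_div_mu {β : ℝ} (hβ0 : 0 < β) (hβ1 : β ≤ 1) :
    Summable fun k : ℕ => 1 / (2 : ℝ) ^ mu β k := by
  set q : ℝ := (2 : ℝ) ^ (-β) with hq
  have hq0 : 0 < q := by positivity
  have hq1 : q < 1 := Real.rpow_lt_one_of_one_lt_of_neg one_lt_two (by linarith)
  have hS : Summable fun n : ℕ => (1 / 2 : ℝ) ^ n + n * q ^ n := by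
    refine (summable_geometric_of_lt_one (by norm_num) (by norm_num)).add ?_
    have := summable_pow_mul_geometric_of_norm_lt_one 1 (r := q) (by
      rwa [Real.norm_of_nonneg hq0.le])
    simpa using this
  have key : ∀ n : ℕ, ∑ k ∈ Finset.range (2 ^ n), 1 / (2 : ℝ) ^ mu β k ≤
      1 + ∑ i ∈ Finset.range n, ((1 / 2 : ℝ) ^ i + i * q ^ i) := by
    intro n
    induction n with
    | zero => simp [mu]
    | succ n ih =>
      rw [pow_succ, mul_two, Finset.sum_range_add, Finset.sum_range_succ, ← add_assoc]
      refine add_le_add ih ?_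
      rw [Finset.sum_congr rfl fun l hl => one_div_two_rpow_mu (Finset.mem_range.1 hl),
        ← Finset.mul_sum, Finset.sum_add_distrib]
      have h1 : ∑ l ∈ Finset.range (2 ^ n), (if l = 0 then (1 : ℝ) else 0) = 1 := by
        rw [Finset.sum_ite_eq' , if_pos (Finset.mem_range.2 (by positivity))]
      rw [h1, mul_add, mul_one]
      refine add_le_add le_rfl ?_
      calc (1 / 2 : ℝ) ^ n * _ ≤ (1 / 2 : ℝ) ^ n * (n * (2 * q) ^ n) := by
            gcongr
            exact sum_rpow_log_le hβ1 n
        _ = n * q ^ n := by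
            rw [mul_left_comm, ← mul_pow, ← mul_assoc]; norm_num
  refine summable_of_sum_range_le (c := 1 + ∑' i : ℕ, ((1 / 2 : ℝ) ^ i + i * q ^ i))
    (fun k => by positivity) fun n => ?_
  refine (Finset.sum_le_sum_of_subset_of_nonneg (Finset.range_mono (Nat.lt_two_pow_self (n := n)).le)
    fun k _ _ => by positivity).trans ((key n).trans ?_)
  gcongr
  exact hS.sum_le_tsum _ fun i _ => by positivity

lemma tsum_prod_le_prod_tsum {ι α : Type*} [Fintype ι] (f : α → ℝ≥0∞) :
    ∑' k : ι → α, ∏ j, f (k j) ≤ ∏ _j : ι, ∑' a, f a := by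
  classical
  rw [ENNReal.tsum_eq_iSup_sum]
  refine iSup_le fun S => ?_
  calc ∑ k ∈ S, ∏ j, f (k j)
      ≤ ∑ k ∈ Fintype.piFinset fun j : ι => S.image fun k => k j, ∏ j, f (k j) := by
        refine Finset.sum_le_sum_of_subset fun k hk => ?_
        exact Fintype.mem_piFinset.2 fun j => Finset.mem_image_of_mem (fun k => k j) hk
    _ = ∏ j : ι, ∑ a ∈ S.image fun k => k j, f a := (Finset.prod_univ_sum _ _).symm
    _ ≤ _ := Finset.prod_le_prod' fun j _ => ENNReal.sum_le_tsum _

lemma abs_mean_le_one {N : ℕ} (a : Fin N → ℝ) (ha : ∀ n, |a n| ≤ 1) :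
    |1 / (N : ℝ) * ∑ n, a n| ≤ 1 := by
  have h1 : |∑ n, a n| ≤ N := (Finset.abs_sum_le_sum_abs _ _).trans
    ((Finset.sum_le_sum fun n _ => ha n).trans_eq (by simp))
  rw [abs_mul, abs_of_nonneg (by positivity), one_div]
  -- For `N = 0` the mean is `0`, since `0⁻¹ = 0`.
  rcases N.eq_zero_or_pos with rfl | hN
  · simp
  · rw [inv_mul_le_one₀ (by positivity)]
    exact h1

/-- The Walsh means are at most `1`, so each inner sum is at most a power of the one-variable
series. -/
lemma errBound_lt_top {s N : ℕ} (γ : Finset (Fin s) → ℝ) (C : ℝ) {β : ℝ} (hβ0 : 0 < β)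
    (hβ1 : β ≤ 1) (P : Fin N → Fin s → ℝ) : errBound γ C β P < ∞ := by
  refine ENNReal.sum_lt_top.2 fun u _ => ENNReal.mul_lt_top ENNReal.ofReal_lt_top ?_
  have hsum : ∑' k : ℕ+, ENNReal.ofReal (1 / (2 : ℝ) ^ mu β k) < ∞ := by
    have := (summable_one_div_mu hβ0 hβ1).comp_injective PNat.coe_injective
    exact this.tsum_ofReal_lt_top
  refine lt_of_le_of_lt (ENNReal.tsum_le_tsum fun k => ?_) (lt_of_le_of_lt
    (tsum_prod_le_prod_tsum fun a : ℕ+ => ENNReal.ofReal (1 / (2 : ℝ) ^ mu β a))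
    (ENNReal.prod_lt_top fun _ _ => hsum))
  rw [← ENNReal.ofReal_prod_of_nonneg (f := fun j => 1 / (2 : ℝ) ^ mu β (k j))
    (fun j _ => by positivity), Finset.prod_div_distrib,
    Finset.prod_const_one, ← Real.rpow_sum_of_pos two_pos]
  refine ENNReal.ofReal_le_ofReal (mul_le_of_le_one_right (by positivity)
    (abs_mean_le_one _ fun n => ?_))
  rw [Finset.abs_prod]
  exact Finset.prod_le_one (fun _ _ => abs_nonneg _) fun j _ => (abs_wal _ _).le

/-! ### The error bound -/

section

variable {s N : ℕ} {φ ψ ω : ℝ → ℝ} {F : (Fin s → ℝ) → ℝ} {γ : Finset (Fin s) → ℝ} {C β : ℝ}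

/-- Nonzero multi-indices are sorted by their supports. -/
lemma sum_supp_le_sum_tsum (S : Finset (Fin s → ℕ)) (hS : ∀ k ∈ S, (supp k).Nonempty)
    (g : (u : Finset (Fin s)) → ({j // j ∈ u} → ℕ) → ℝ≥0∞) :
    ∑ k ∈ S, g (supp k) (fun j => k j) ≤
      ∑ u : Finset (Fin s) with u.Nonempty, ∑' k : {j // j ∈ u} → ℕ+, g u fun j => k j := by
  rw [← Finset.sum_fiberwise_of_maps_to (t := Finset.univ.filter Finset.Nonempty) (g := supp)
    fun k hk => Finset.mem_filter.2 ⟨Finset.mem_univ _, hS k hk⟩]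
  refine Finset.sum_le_sum fun u _ => ?_
  -- `Nat.toPNat'` sends `0` to `1`, but only nonzero entries are read, as `u` is the support.
  let r : (Fin s → ℕ) → {j // j ∈ u} → ℕ+ := fun k j => (k j).toPNat'
  have hr : ∀ k ∈ S.filter fun k => supp k = u, ∀ j : {j // j ∈ u}, ((r k j : ℕ+) : ℕ) = k j := by
    intro k hk j
    have h1 := (Finset.mem_filter.1 hk).2
    have h2 : k j ≠ 0 := mem_supp.1 (h1 ▸ j.2)
    simp only [r, Nat.toPNat'_coe, if_pos (Nat.pos_of_ne_zero h2)]
  have hinj : Set.InjOn r ↑(S.filter fun k => supp k = u) := by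
    intro k hk k' hk' hkk
    funext j
    by_cases hj : j ∈ u
    · rw [← hr k hk ⟨j, hj⟩, ← hr k' hk' ⟨j, hj⟩, hkk]
    · have h1 : k j = 0 := by
        by_contra hne
        exact hj ((Finset.mem_filter.1 hk).2 ▸ mem_supp.2 hne)
      have h2 : k' j = 0 := by
        by_contra hne
        exact hj ((Finset.mem_filter.1 hk').2 ▸ mem_supp.2 hne)
      rw [h1, h2]
  calc ∑ k ∈ S with supp k = u, g (supp k) (fun j => k j)
      = ∑ k ∈ S with supp k = u, g u fun j => r k j := by
        refine Finset.sum_congr rfl fun k hk => ?_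
        have e : (fun j : {j // j ∈ u} => ((r k j : ℕ+) : ℕ)) = fun j => k j.1 := funext (hr k hk)
        rw [e]
        obtain rfl := (Finset.mem_filter.1 hk).2
        rfl
    _ = ∑ k' ∈ (S.filter fun k => supp k = u).image r, g u fun j => k' j :=
        (Finset.sum_image (f := fun k' : {j // j ∈ u} → ℕ+ => g u fun j => k' j) hinj).symm
    _ ≤ _ := ENNReal.sum_le_tsum _

lemma prod_wal_eq (k : Fin s → ℕ) (p : Fin s → ℝ) :
    ∏ j, wal (k j) (p j) = ∏ j : {j // j ∈ supp k}, wal (k j) (p j) := by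
  rw [Finset.prod_coe_sort (supp k) fun j => wal (k j) (p j)]
  refine (Finset.prod_subset (Finset.subset_univ _) fun j _ hj => ?_).symm
  have : k j = 0 := by simpa [mem_supp] using hj
  rw [this, wal_zero]

lemma supp_nonempty {k : Fin s → ℕ} (hk : k ≠ 0) : (supp k).Nonempty := by
  obtain ⟨j, hj⟩ := Function.ne_iff.1 hk
  exact ⟨j, mem_supp.2 hj⟩

/-- Convergence along the cubes `B m` is enough: every partial sum obeys the bound, which is closed
under limits. -/
lemma ofReal_abs_err_le (h : IsDensity φ) (hψm : Measurable ψ) (hψ : ∀ x, 0 < ψ x)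
    (hωm : Measurable ω) (hω : ∀ x, 0 < ω x) (hA : AssumptionA φ ψ ω C β) (hγ : ∀ u, 0 < γ u)
    (hF : MemSpace γ φ ψ ω F) (hN : N ≠ 0) {P : Fin N → Fin s → ℝ}
    (hP : ∀ n j, P n j ∈ Ioo (0 : ℝ) 1) :
    ENNReal.ofReal |err φ P F| ≤ wNorm γ φ ψ ω F * errBound γ C β P := by
  have hFi : Integrable fun x => F x * ∏ j, φ (x j) :=
    (integrable_pi_densMeasure_iff (d := fun _ => φ) (fun _ => h.measurable)
      fun _ t => (h.pos t).le).1 (integrable_of_memSpace h hF)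
  let A : (Fin s → ℕ) → ℝ := fun k => 1 / (N : ℝ) * ∑ n, ∏ j, wal (k j) (P n j)
  let B : ℕ → Finset (Fin s → ℕ) := fun m => Fintype.piFinset fun _ => Finset.range (2 ^ m)
  have hlim : Tendsto (fun m => (∫ x, F x * prodDensity φ x) - 1 / (N : ℝ) *
      ∑ n, ∑ k ∈ B m, walCoeff φ F k * ∏ j, wal (k j) (P n j)) atTop (𝓝 (err φ P F)) :=
    ((tendsto_finsetSum _ fun n _ => tendsto_sum_walCoeff h hF.continuous hFi (hP n)).const_mul
      _).const_sub _
  -- The term `k = 0` is the exact integral and cancels; its mean is `1` because there is at least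
  -- one point.
  have hEq : ∀ m, (∫ x, F x * prodDensity φ x) - 1 / (N : ℝ) *
      ∑ n, ∑ k ∈ B m, walCoeff φ F k * ∏ j, wal (k j) (P n j) =
      -∑ k ∈ (B m).erase 0, walCoeff φ F k * A k := by
    intro m
    have h0 : (0 : Fin s → ℕ) ∈ B m := Fintype.mem_piFinset.2 fun _ =>
      Finset.mem_range.2 (by simp)
    have hA0 : A 0 = 1 := by
      have : (N : ℝ) ≠ 0 := Nat.cast_ne_zero.2 hN
      simp [A, this]
    have hc0 : walCoeff φ F 0 = ∫ x, F x * prodDensity φ x := by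
      simp [walCoeff, prodDensity]
    have : 1 / (N : ℝ) * ∑ n, ∑ k ∈ B m, walCoeff φ F k * ∏ j, wal (k j) (P n j) =
        ∑ k ∈ B m, walCoeff φ F k * A k := by
      rw [Finset.sum_comm, Finset.mul_sum]
      refine Finset.sum_congr rfl fun k _ => ?_
      rw [← Finset.mul_sum]
      ring
    rw [this, ← Finset.add_sum_erase _ _ h0, hA0, hc0]
    ring
  refine le_of_tendsto ((ENNReal.continuous_ofReal.tendsto _).comp hlim.abs)
    (Eventually.of_forall fun m => ?_)
  rw [Function.comp_apply, hEq, abs_neg, ← Real.enorm_eq_ofReal_abs]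
  let g : (u : Finset (Fin s)) → ({j // j ∈ u} → ℕ) → ℝ≥0∞ := fun u k =>
    ENNReal.ofReal (γ u * (2 * max C (1 / 2)) ^ u.card) *
      ENNReal.ofReal (1 / (2 : ℝ) ^ (∑ j, mu β (k j)) *
        |1 / (N : ℝ) * ∑ n, ∏ j, wal (k j) (P n j)|)
  calc ‖∑ k ∈ (B m).erase 0, walCoeff φ F k * A k‖ₑ
      ≤ ∑ k ∈ (B m).erase 0, ‖walCoeff φ F k * A k‖ₑ := enorm_sum_le _ _
    _ ≤ ∑ k ∈ (B m).erase 0, wNorm γ φ ψ ω F * g (supp k) fun j => k j := by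
        refine Finset.sum_le_sum fun k hk => ?_
        have hk0 := supp_nonempty (Finset.ne_of_mem_erase hk)
        rw [enorm_mul, Real.enorm_eq_ofReal_abs (A k)]
        refine (mul_le_mul_left (enorm_walCoeff_le h hψm hψ hωm hω hA hγ hF hk0) _).trans
          (le_of_eq ?_)
        simp only [g, A, ← prod_wal_eq]
        rw [mul_assoc, mul_assoc, ← ENNReal.ofReal_mul (by positivity)]
    _ = wNorm γ φ ψ ω F * ∑ k ∈ (B m).erase 0, g (supp k) fun j => k j :=
        (Finset.mul_sum ..).symm
    _ ≤ _ := by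
        gcongr
        refine (sum_supp_le_sum_tsum _ (fun k hk => supp_nonempty (Finset.ne_of_mem_erase hk))
          g).trans (le_of_eq ?_)
        simp only [g, ENNReal.tsum_mul_left]
        rfl

end

end LocWalsh

end

theorem mainTheorem3 (s m : ℕ) (γ : Finset (Fin s) → ℝ) (hγ : ∀ u, 0 < γ u)
    (φ ψ ω : ℝ → ℝ) (hφ_pos : ∀ x, 0 < φ x) (hφ_int : ∫ x, φ x = 1)
    (hφ_diff : Differentiable ℝ φ)
    (hψ_meas : Measurable ψ) (hψ_pos : ∀ x, 0 < ψ x)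
    (hω_meas : Measurable ω) (hω_pos : ∀ x, 0 < ω x)
    (C β : ℝ) (hA : LocWalsh.AssumptionA φ ψ ω C β)
    (P : Fin (2 ^ m) → Fin s → ℝ) (hP : ∀ n j, P n j ∈ Set.Ioo (0 : ℝ) 1) :
    LocWalsh.errBound γ C β P < ∞ ∧
    (∀ F : (Fin s → ℝ) → ℝ, LocWalsh.MemSpace γ φ ψ ω F →
      |LocWalsh.err φ P F| ≤
        (LocWalsh.wNorm γ φ ψ ω F).toReal * (LocWalsh.errBound γ C β P).toReal) ∧
    LocWalsh.wce γ φ ψ ω P ≤ LocWalsh.errBound γ C β P := by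
  have h : LocWalsh.IsDensity φ := ⟨hφ_pos, hφ_int, hφ_diff⟩
  have hE := LocWalsh.errBound_lt_top γ C hA.β_pos hA.β_le_one P
  have hN : 2 ^ m ≠ 0 := by positivity
  refine ⟨hE, fun F hF => ?_, iSup_le fun F => iSup₂_le fun hF h1 => ?_⟩
  · have := LocWalsh.ofReal_abs_err_le h hψ_meas hψ_pos hω_meas hω_pos hA hγ hF hN hP
    rw [← ENNReal.toReal_mul]
    -- Both factors are finite, so `toReal` does not collapse `∞` to `0`.
    exact (ENNReal.ofReal_le_iff_le_toReal (ENNReal.mul_lt_top hF.norm_lt_top hE).ne).1 this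
  · refine (LocWalsh.ofReal_abs_err_le h hψ_meas hψ_pos hω_meas hω_pos hA hγ hF hN hP).trans ?_
    exact mul_le_of_le_one_left' h1
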